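/- Let $-\infty<a<b<\infty$, let $m,r,l\ge 1$ and $n\ge 0$ be integers and $1\le p\le\infty$. Let $W_p^{0}=L_p([a,b];\mathbb C)$ and, for $s\ge 1$, let $W_p^{s}$ be the Sobolev space of all $y\in C^{s-1}([a,b];\mathbb C)$ with $y^{(s-1)}$ absolutely continuous and $y^{(s)}\in L_p$, with norm $\sum_{k=0}^{s}\|y^{(k)}\|_p$. Let $A_0,\dots,A_{r-1}\in (W_p^{n})^{m\times m}$, let $B\colon (W_p^{n+r})^m\to\mathbb C^l$ be a continuous linear operator, and put $Ly=y^{(r)}+\sum_{j=1}^{r}A_{r-j}\,y^{(r-j)}$, so that $$(L,B)\colon (W_p^{n+r})^m\to (W_p^{n})^m\times\mathbb C^l .$$ For $k\in\{0,\dots,r-1\}$ let $Y_k\in (W_p^{n+r})^{m\times m}$ be the solution of the matrix Cauchy problem $$Y_k^{(r)}+\sum_{j=1}^{r}A_{r-j}Y_k^{(r-j)}=O_m\ \text{ on }(a,b),\qquad Y_k^{(j)}(a)=\delta_{k,j}I_m,\quad j=0,\dots,r-1$$ (the equation holds almost everywhere if $n=0$ and everywhere if $n\ge1$). Let $[BY_k]\in\mathbb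 C^{l\times m}$ be the matrix whose $c$-th column is the value of $B$ at the $c$-th column of $Y_k$. The characteristic matrix of $(L,B)$ is $M(L,B)=([BY_0],\dots,[BY_{r-1}])\in\mathbb C^{l\times mr}$. For each $k\in\mathbb N$ let $(L(k),B(k))$ be an operator of the same kind, with the same $a,b,p,m,n,r,l$. Suppose that $(L(k),B(k))$ converges strongly to $(L,B)$, that is, $(L(k)y,B(k)y)\to(Ly,By)$ in $(W_p^{n})^m\times\mathbb C^l$ for every $y\in(W_p^{n+r})^m$. Then the matrix Cauchy problems above, for $L$ and for every $L(k)$, are uniquely solvable in $(W_p^{n+r})^{m\times m}$ (so that the characteristic matrices are well defined), and $M(L(k),B(k))\to M(L,B)$ as $k\to\infty$. -/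

import Mathlib

open MeasureTheory Set Filter Topology
open scoped ENNReal

/-- `SobolevMem a b p s y`: the function `y` (only its values on `[a, b]` matter) lies in the
Sobolev space `W_p^s([a, b]; ℂ)`. For `s = 0` this is `L_p`; for `s + 1` it means
`y ∈ C^s[a, b]`, `y^(s)` is absolutely continuous on `[a, b]`, and `y^(s+1) ∈ L_p[a, b]`. -/
def SobolevMem (a b : ℝ) (p : ℝ≥0∞) : ℕ → (ℝ → ℂ) → Prop
  | 0, y => MemLp y p (volume.restrict (Icc a b))
  | s + 1, y => ContDiffOn ℝ s y (Icc a b) ∧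
      AbsolutelyContinuousOnInterval (iteratedDerivWithin s y (Icc a b)) a b ∧
      MemLp (iteratedDerivWithin (s + 1) y (Icc a b)) p (volume.restrict (Icc a b))

section Aux

variable {a b : ℝ} {p : ℝ≥0∞} {s : ℕ} {y z : ℝ → ℂ}

theorem memLp_of_continuousOn_Icc (h : ContinuousOn y (Icc a b)) (q : ℝ≥0∞) :
    MemLp y q (volume.restrict (Icc a b)) := by
  obtain ⟨C, hC⟩ := isCompact_Icc.exists_bound_of_continuousOn h
  refine MemLp.of_bound (h.aestronglyMeasurable measurableSet_Icc) C ?_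
  filter_upwards [ae_restrict_mem measurableSet_Icc] with t ht using hC t ht

theorem AbsolutelyContinuousOnInterval.ae_differentiableWithinAt_Icc (hab : a < b)
    (h : AbsolutelyContinuousOnInterval y a b) :
    ∀ᵐ t ∂(volume.restrict (Icc a b)), DifferentiableWithinAt ℝ y (Icc a b) t := by
  have := h.boundedVariationOn.ae_differentiableAt_of_mem_uIcc
  rw [uIcc_of_le hab.le] at this
  rw [ae_restrict_iff' measurableSet_Icc]
  filter_upwards [this] with t ht hm using (ht hm).differentiableWithinAt

theorem AbsolutelyContinuousOnInterval.congr_Icc (hab : a < b) (hyz : EqOn y z (Icc a b))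
    (h : AbsolutelyContinuousOnInterval y a b) : AbsolutelyContinuousOnInterval z a b := by
  rw [absolutelyContinuousOnInterval_iff] at h ⊢
  intro ε hε
  obtain ⟨δ, hδ, H⟩ := h ε hε
  refine ⟨δ, hδ, fun E hE hl => ?_⟩
  refine lt_of_eq_of_lt (Finset.sum_congr rfl fun i hi => ?_) (H E hE hl)
  have := hE.1 i hi
  rw [uIcc_of_le hab.le] at this
  rw [hyz this.1, hyz this.2]

theorem AbsolutelyContinuousOnInterval.finsetSum {ι : Type*} (S : Finset ι) {f : ι → ℝ → ℂ}
    (h : ∀ i ∈ S, AbsolutelyContinuousOnInterval (f i) a b) :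
    AbsolutelyContinuousOnInterval (fun t => ∑ i ∈ S, f i t) a b := by
  classical
  induction S using Finset.induction_on with
  | empty =>
    simp only [Finset.sum_empty]
    exact (contDiff_const.contDiffOn (n := 1)).absolutelyContinuousOnInterval
  | insert i S hi IH =>
    simp only [Finset.sum_insert hi]
    exact (h i (Finset.mem_insert_self _ _)).fun_add
      (IH fun j hj => h j (Finset.mem_insert_of_mem hj))

theorem iteratedDerivWithin_iteratedDerivWithin (k q : ℕ) (f : ℝ → ℂ) (S : Set ℝ) :
    iteratedDerivWithin k (iteratedDerivWithin q f S) S = iteratedDerivWithin (k + q) f S := by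
  induction k with
  | zero => simp
  | succ k IH => rw [iteratedDerivWithin_succ, IH, Nat.succ_add, iteratedDerivWithin_succ]

/-- All derivatives up to order `s` of an element of `W_p^s` are in `L_p`. -/
theorem SobolevMem.memLp (hab : a < b) (h : SobolevMem a b p s y) {k : ℕ} (hk : k ≤ s) :
    MemLp (iteratedDerivWithin k y (Icc a b)) p (volume.restrict (Icc a b)) := by
  cases s with
  | zero =>
    obtain rfl : k = 0 := by omega
    simpa [SobolevMem] using h
  | succ s =>
    obtain ⟨h1, -, h3⟩ := h
    rcases Nat.lt_or_ge k (s + 1) with hk' | hk'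
    · exact memLp_of_continuousOn_Icc (h1.continuousOn_iteratedDerivWithin
        (by exact_mod_cast Nat.lt_succ_iff.mp hk') (uniqueDiffOn_Icc hab)) p
    · obtain rfl : k = s + 1 := le_antisymm hk hk'
      exact h3

/-- Derivatives up to order `s` are additive, almost everywhere, on `W_p^s`. -/
theorem SobolevMem.deriv_add_ae (hab : a < b) (hy : SobolevMem a b p s y)
    (hz : SobolevMem a b p s z) {k : ℕ} (hk : k ≤ s) :
    iteratedDerivWithin k (y + z) (Icc a b) =ᵐ[volume.restrict (Icc a b)]
      iteratedDerivWithin k y (Icc a b) + iteratedDerivWithin k z (Icc a b) := by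
  have hu := uniqueDiffOn_Icc hab
  cases s with
  | zero =>
    obtain rfl : k = 0 := by omega
    simp
  | succ s =>
    obtain ⟨hy1, hy2, -⟩ := hy
    obtain ⟨hz1, hz2, -⟩ := hz
    have key : ∀ j : ℕ, j ≤ s → EqOn (iteratedDerivWithin j (y + z) (Icc a b))
        (iteratedDerivWithin j y (Icc a b) + iteratedDerivWithin j z (Icc a b)) (Icc a b) := by
      intro j hj t ht
      have hj' : (j : WithTop ℕ∞) ≤ s := by exact_mod_cast hj
      exact iteratedDerivWithin_add ht hu ((hy1 t ht).of_le hj') ((hz1 t ht).of_le hj')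
    rcases Nat.lt_or_ge k (s + 1) with hk' | hk'
    · filter_upwards [ae_restrict_mem measurableSet_Icc] with t ht
        using key k (Nat.lt_succ_iff.mp hk') ht
    · obtain rfl : k = s + 1 := le_antisymm hk hk'
      filter_upwards [ae_restrict_mem measurableSet_Icc, hy2.ae_differentiableWithinAt_Icc hab,
        hz2.ae_differentiableWithinAt_Icc hab] with t ht hdy hdz
      rw [iteratedDerivWithin_succ, derivWithin_congr (key s le_rfl) (key s le_rfl ht),
        derivWithin_add hdy hdz, Pi.add_apply, iteratedDerivWithin_succ, iteratedDerivWithin_succ]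

theorem SobolevMem.add (hab : a < b) (hy : SobolevMem a b p s y) (hz : SobolevMem a b p s z) :
    SobolevMem a b p s (y + z) := by
  have hae := fun k hk => SobolevMem.deriv_add_ae hab hy hz (k := k) hk
  have hL := (hy.memLp hab le_rfl).add (hz.memLp hab le_rfl)
  cases s with
  | zero => exact MemLp.add hy hz
  | succ s =>
    refine ⟨hy.1.add hz.1, ?_, hL.ae_eq (hae _ le_rfl).symm⟩
    refine (hy.2.1.add hz.2.1).congr_Icc hab fun t ht => ?_
    exact (iteratedDerivWithin_add ht (uniqueDiffOn_Icc hab) (hy.1 t ht) (hz.1 t ht)).symm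

theorem SobolevMem.smul (c : ℂ) (hy : SobolevMem a b p s y) : SobolevMem a b p s (c • y) := by
  have hd : ∀ k, iteratedDerivWithin k (c • y) (Icc a b)
      = c • iteratedDerivWithin k y (Icc a b) := fun k => by
    ext t; simp
  cases s with
  | zero => exact MemLp.const_smul hy c
  | succ s =>
    refine ⟨hy.1.const_smul c, ?_, ?_⟩
    · rw [hd]; exact hy.2.1.const_smul c
    · rw [hd]; exact hy.2.2.const_smul c

theorem SobolevMem.zero : SobolevMem a b p s (0 : ℝ → ℂ) := by
  have hd : ∀ k, iteratedDerivWithin k (0 : ℝ → ℂ) (Icc a b) = 0 := fun k => by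
    ext t; simp
  cases s with
  | zero => exact MemLp.zero
  | succ s =>
    refine ⟨contDiffOn_const, ?_, ?_⟩
    · rw [hd]; exact (contDiff_const.contDiffOn (n := 1)).absolutelyContinuousOnInterval
    · rw [hd]; exact MemLp.zero

/-- `W_p^(s+1) ⊆ W_p^s`. -/
theorem SobolevMem.of_succ (hab : a < b) (h : SobolevMem a b p (s + 1) y) :
    SobolevMem a b p s y := by
  have hu := uniqueDiffOn_Icc hab
  have hL := h.memLp hab (Nat.le_succ s)
  cases s with
  | zero => simpa [SobolevMem] using hL
  | succ s =>
    refine ⟨h.1.of_le (by exact_mod_cast Nat.le_succ s), ?_, hL⟩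
    have := ((contDiffOn_nat_succ_iff_contDiffOn_one_iteratedDerivWithin hu).1 h.1).2
    rw [← uIcc_of_le hab.le] at this
    simpa [uIcc_of_le hab.le] using this.absolutelyContinuousOnInterval

theorem SobolevMem.mono (hab : a < b) (h : SobolevMem a b p s y) {k : ℕ} (hk : k ≤ s) :
    SobolevMem a b p k y := by
  induction s, hk using Nat.le_induction with
  | base => exact h
  | succ s _ IH => exact IH (h.of_succ hab)

/-- If `y ∈ W_p^(s+q)`, then `y^(q) ∈ W_p^s`. -/
theorem SobolevMem.iteratedDeriv (hab : a < b) {q : ℕ} (h : SobolevMem a b p (s + q) y) :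
    SobolevMem a b p s (iteratedDerivWithin q y (Icc a b)) := by
  have hu := uniqueDiffOn_Icc hab
  have hL := fun k hk => h.memLp hab (k := k) hk
  cases s with
  | zero => exact hL q (by omega)
  | succ s =>
    rw [Nat.succ_add] at h
    refine ⟨?_, ?_, ?_⟩
    · have h1 := (contDiffOn_nat_iff_continuousOn_differentiableOn_deriv hu).1 h.1
      refine (contDiffOn_nat_iff_continuousOn_differentiableOn_deriv hu).2
        ⟨fun k hk => ?_, fun k hk => ?_⟩
      · rw [iteratedDerivWithin_iteratedDerivWithin]; exact h1.1 _ (by omega)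
      · rw [iteratedDerivWithin_iteratedDerivWithin]; exact h1.2 _ (by omega)
    · rw [iteratedDerivWithin_iteratedDerivWithin]; exact h.2.1
    · rw [iteratedDerivWithin_iteratedDerivWithin]; exact hL _ (by omega)

/-- For `i ≤ s`, the derivative `y^(i)` of `y ∈ W_p^(s+1)` is absolutely continuous. -/
theorem SobolevMem.absolutelyContinuous (hab : a < b) (h : SobolevMem a b p (s + 1) y) {i : ℕ}
    (hi : i ≤ s) : AbsolutelyContinuousOnInterval (iteratedDerivWithin i y (Icc a b)) a b :=
  (h.mono hab (k := i + 1) (by omega)).2.1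

/-- `W_p^s · W_p^(s+1) ⊆ W_p^s`. -/
theorem SobolevMem.mul (hab : a < b) (hy : SobolevMem a b p s y)
    (hz : SobolevMem a b p (s + 1) z) : SobolevMem a b p s (y * z) := by
  have hu := uniqueDiffOn_Icc hab
  cases s with
  | zero =>
    have hz0 : ContinuousOn z (Icc a b) := hz.1.continuousOn
    exact MemLp.mul (p := p) (q := ∞) (r := p) (memLp_of_continuousOn_Icc hz0 ∞) hy
  | succ s =>
    have hz' := hz.of_succ hab
    have hleib : EqOn (iteratedDerivWithin s (y * z) (Icc a b)) (fun t =>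
        ∑ i ∈ Finset.range (s + 1), (s.choose i : ℂ) * (iteratedDerivWithin i y (Icc a b) t *
          iteratedDerivWithin (s - i) z (Icc a b) t)) (Icc a b) := fun t ht => by
      rw [iteratedDerivWithin_mul ht hu (hy.1 t ht) (hz'.1 t ht)]
      simp only [mul_assoc]
    have hACy : ∀ i, i ≤ s → AbsolutelyContinuousOnInterval
        (iteratedDerivWithin i y (Icc a b)) a b := fun i hi => hy.absolutelyContinuous hab hi
    have hACz : ∀ i, i ≤ s → AbsolutelyContinuousOnInterval
        (iteratedDerivWithin i z (Icc a b)) a b := fun i hi => hz'.absolutelyContinuous hab hi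
    have hcont : ∀ f : ℝ → ℂ, AbsolutelyContinuousOnInterval f a b →
        MemLp f ∞ (volume.restrict (Icc a b)) := fun f hf => by
      have := hf.continuousOn
      rw [uIcc_of_le hab.le] at this
      exact memLp_of_continuousOn_Icc this ∞
    refine ⟨hy.1.mul hz'.1, ?_, ?_⟩
    · refine AbsolutelyContinuousOnInterval.congr_Icc hab hleib.symm
        (AbsolutelyContinuousOnInterval.finsetSum _ fun i hi => ?_)
      have hi' : i ≤ s := Nat.lt_succ_iff.mp (Finset.mem_range.mp hi)
      exact ((hACy i hi').fun_smul (hACz (s - i) (Nat.sub_le _ _))).const_smul (s.choose i : ℂ)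
    · have hsum : MemLp (fun t => ∑ i ∈ Finset.range (s + 1), (s.choose i : ℂ) *
          (iteratedDerivWithin (i + 1) y (Icc a b) t * iteratedDerivWithin (s - i) z (Icc a b) t +
          iteratedDerivWithin i y (Icc a b) t * iteratedDerivWithin (s - i + 1) z (Icc a b) t))
          p (volume.restrict (Icc a b)) := by
        refine memLp_finsetSum _ fun i hi => MemLp.const_mul ?_ _
        have hi' : i ≤ s := Nat.lt_succ_iff.mp (Finset.mem_range.mp hi)
        refine MemLp.add ?_ ?_
        · exact MemLp.mul (p := p) (q := ∞) (r := p) (hcont _ (hACz (s - i) (Nat.sub_le _ _)))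
            (hy.memLp hab (by omega))
        · exact MemLp.mul (p := ∞) (q := p) (r := p) (hz'.memLp hab (by omega)) (hcont _ (hACy i hi'))
      refine hsum.ae_eq ?_
      have hdy : ∀ᵐ t ∂(volume.restrict (Icc a b)), ∀ i : Fin (s + 1),
          DifferentiableWithinAt ℝ (iteratedDerivWithin i y (Icc a b)) (Icc a b) t :=
        ae_all_iff.2 fun i => (hACy i (Nat.lt_succ_iff.mp i.2)).ae_differentiableWithinAt_Icc hab
      have hdz : ∀ᵐ t ∂(volume.restrict (Icc a b)), ∀ i : Fin (s + 1),
          DifferentiableWithinAt ℝ (iteratedDerivWithin i z (Icc a b)) (Icc a b) t :=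
        ae_all_iff.2 fun i => (hACz i (Nat.lt_succ_iff.mp i.2)).ae_differentiableWithinAt_Icc hab
      filter_upwards [ae_restrict_mem measurableSet_Icc, hdy, hdz] with t ht hty htz
      rw [iteratedDerivWithin_succ, derivWithin_congr hleib (hleib ht)]
      have hD : ∀ i ∈ Finset.range (s + 1), HasDerivWithinAt (fun t => (s.choose i : ℂ) *
          (iteratedDerivWithin i y (Icc a b) t * iteratedDerivWithin (s - i) z (Icc a b) t))
          ((s.choose i : ℂ) * (iteratedDerivWithin (i + 1) y (Icc a b) t *
            iteratedDerivWithin (s - i) z (Icc a b) t + iteratedDerivWithin i y (Icc a b) t *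
            iteratedDerivWithin (s - i + 1) z (Icc a b) t)) (Icc a b) t := fun i hi => by
        have h1 := (hty ⟨i, Finset.mem_range.mp hi⟩).hasDerivWithinAt
        have h2 := (htz ⟨s - i, by omega⟩).hasDerivWithinAt
        rw [← iteratedDerivWithin_succ] at h1 h2
        exact (h1.mul h2).const_mul _
      exact ((HasDerivWithinAt.fun_sum hD).derivWithin (hu t ht)).symm

theorem SobolevMem.finsetSum (hab : a < b) {ι : Type*} (S : Finset ι) {f : ι → ℝ → ℂ}
    (h : ∀ i ∈ S, SobolevMem a b p s (f i)) : SobolevMem a b p s (∑ i ∈ S, f i) :=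
  Finset.sum_induction f _ (fun _ _ => SobolevMem.add hab) SobolevMem.zero h

end Aux

/-- The functions of class `W_p^s` on `[a, b]`, as a linear subspace of all functions. -/
def sobolevSubmodule (a b : ℝ) [hab : Fact (a < b)] (p : ℝ≥0∞) (s : ℕ) : Submodule ℂ (ℝ → ℂ) where
  carrier := {y | SobolevMem a b p s y}
  add_mem' := fun hy hz => SobolevMem.add hab.out hy hz
  zero_mem' := SobolevMem.zero
  smul_mem' := fun c _ hy => SobolevMem.smul c hy

/-- The functions of class `W_p^s` on `[a, b]`, before functions that agree (almost everywhere)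
on `[a, b]` are identified; the type carries the norm of `W_p^s` as a seminorm. -/
def SobolevFun (a b : ℝ) [Fact (a < b)] (p : ℝ≥0∞) (s : ℕ) : Type :=
  sobolevSubmodule a b p s

namespace SobolevFun

variable {a b : ℝ} [hab : Fact (a < b)] {p : ℝ≥0∞} {s : ℕ}

noncomputable instance : AddCommGroup (SobolevFun a b p s) :=
  inferInstanceAs (AddCommGroup (sobolevSubmodule a b p s))

noncomputable instance : Module ℂ (SobolevFun a b p s) :=
  inferInstanceAs (Module ℂ (sobolevSubmodule a b p s))

/-- The element of `SobolevFun` given by a function of class `W_p^s`. -/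
def ofFun (y : ℝ → ℂ) (hy : SobolevMem a b p s y) : SobolevFun a b p s := ⟨y, hy⟩

/-- The underlying function. -/
def toFun (y : SobolevFun a b p s) : ℝ → ℂ := y.1

theorem mem (y : SobolevFun a b p s) : SobolevMem a b p s y.toFun := y.2

/-- The `k`-th derivative on `[a, b]` (one-sided at the end points). -/
noncomputable def deriv (k : ℕ) (y : SobolevFun a b p s) : ℝ → ℂ :=
  iteratedDerivWithin k y.toFun (Icc a b)

theorem memLp_deriv (y : SobolevFun a b p s) (k : Fin (s + 1)) :
    MemLp (y.deriv k) p (volume.restrict (Icc a b)) :=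
  y.mem.memLp hab.out (Nat.lt_succ_iff.mp k.2)

/-- The linear map `y ↦ (y, y', …, y^(s))` into the `ℓ¹`-sum of `s + 1` copies of `L_p(a, b)`. -/
noncomputable def jet [Fact (1 ≤ p)] :
    SobolevFun a b p s →ₗ[ℂ]
      PiLp 1 (fun _ : Fin (s + 1) => Lp ℂ p (volume.restrict (Icc a b))) where
  toFun y := WithLp.toLp 1 fun k => (y.memLp_deriv k).toLp (y.deriv k)
  map_add' y z := by
    ext1 k
    exact (MemLp.toLp_congr ((y + z).memLp_deriv k) ((y.memLp_deriv k).add (z.memLp_deriv k))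
      (SobolevMem.deriv_add_ae hab.out y.mem z.mem (Nat.lt_succ_iff.mp k.2))).trans
      (MemLp.toLp_add (y.memLp_deriv k) (z.memLp_deriv k))
  map_smul' c y := by
    ext1 k
    exact (MemLp.toLp_congr ((c • y).memLp_deriv k) ((y.memLp_deriv k).const_smul c)
      (ae_of_all _ fun t => iteratedDerivWithin_const_smul_field c y.toFun)).trans
      (MemLp.toLp_const_smul c (y.memLp_deriv k))

noncomputable instance [Fact (1 ≤ p)] : SeminormedAddCommGroup (SobolevFun a b p s) :=
  SeminormedAddCommGroup.induced _ _ (jet (a := a) (b := b) (p := p) (s := s))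

noncomputable instance [Fact (1 ≤ p)] : NormedSpace ℂ (SobolevFun a b p s) :=
  NormedSpace.induced ℂ (SobolevFun a b p s) _ (jet (a := a) (b := b) (p := p) (s := s))

/-- The norm is `‖y‖_{s,p} = ∑_{k ≤ s} ‖y^(k)‖_p`. -/
theorem norm_def [Fact (1 ≤ p)] (y : SobolevFun a b p s) :
    ‖y‖ = ∑ k : Fin (s + 1), (eLpNorm (y.deriv k) p (volume.restrict (Icc a b))).toReal := by
  change ‖jet y‖ = _
  rw [PiLp.norm_eq_of_L1]
  exact Finset.sum_congr rfl fun k _ => Lp.norm_toLp _ (y.memLp_deriv k)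

theorem deriv_add_ae (y z : SobolevFun a b p s) {k : ℕ} (hk : k ≤ s) :
    (y + z).deriv k =ᵐ[volume.restrict (Icc a b)] y.deriv k + z.deriv k :=
  SobolevMem.deriv_add_ae hab.out y.mem z.mem hk

theorem deriv_smul (c : ℂ) (y : SobolevFun a b p s) (k : ℕ) :
    (c • y).deriv k = c • y.deriv k :=
  funext fun _ => iteratedDerivWithin_const_smul_field c y.toFun

end SobolevFun

/-- The Sobolev space `W_p^s([a, b]; ℂ)` with the norm `∑_{k ≤ s} ‖y^(k)‖_p`: functions of class
`W_p^s`, modulo functions of norm zero. -/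
abbrev Sobolev (a b : ℝ) [Fact (a < b)] (p : ℝ≥0∞) [Fact (1 ≤ p)] (s : ℕ) : Type :=
  SeparationQuotient (SobolevFun a b p s)

namespace Sobolev

variable {a b : ℝ} [hab : Fact (a < b)] {p : ℝ≥0∞} [Fact (1 ≤ p)] {s : ℕ}

/-- A representative of `y ∈ W_p^s`. -/
noncomputable def rep (y : Sobolev a b p s) : SobolevFun a b p s :=
  SeparationQuotient.outCLM ℂ (SobolevFun a b p s) y

/-- The `k`-th derivative of (a representative of) `y ∈ W_p^s`. For `k < s` its values on `[a, b]`
do not depend on the representative; for `k = s` they are determined almost everywhere. -/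
noncomputable def deriv (k : ℕ) (y : Sobolev a b p s) : ℝ → ℂ := y.rep.deriv k

theorem mk_eq_of_ae {y z : SobolevFun a b p s}
    (h : y.toFun =ᵐ[volume.restrict (Icc a b)] z.toFun) :
    (SeparationQuotient.mk y : Sobolev a b p s) = SeparationQuotient.mk z := by
  have hj : SobolevFun.jet y = SobolevFun.jet z := by
    ext1 k
    refine MemLp.toLp_congr (y.memLp_deriv k) (z.memLp_deriv k) ?_
    cases s with
    | zero =>
      have hk : (k : ℕ) = 0 := by omega
      simpa [SobolevFun.deriv, hk] using h
    | succ s =>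
      have he : EqOn y.toFun z.toFun (Icc a b) :=
        Measure.eqOn_Icc_of_ae_eq volume hab.out.ne h y.mem.1.continuousOn z.mem.1.continuousOn
      filter_upwards [ae_restrict_mem measurableSet_Icc] with t ht
        using iteratedDerivWithin_congr he ht
  rw [SeparationQuotient.mk_eq_mk, Metric.inseparable_iff, dist_eq_norm]
  change ‖SobolevFun.jet (y - z)‖ = 0
  rw [map_sub, hj, sub_self, norm_zero]

/-- Functions with the same class have the same derivatives of order `≤ s`, almost everywhere. -/
theorem deriv_ae_eq_of_mk_eq {y z : SobolevFun a b p s}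
    (h : (SeparationQuotient.mk y : Sobolev a b p s) = SeparationQuotient.mk z)
    {k : ℕ} (hk : k ≤ s) : y.deriv k =ᵐ[volume.restrict (Icc a b)] z.deriv k := by
  rw [SeparationQuotient.mk_eq_mk, Metric.inseparable_iff, dist_eq_norm] at h
  change ‖SobolevFun.jet (y - z)‖ = 0 at h
  rw [map_sub, norm_eq_zero, sub_eq_zero] at h
  have hj := congrArg (fun v => v.ofLp (⟨k, Nat.lt_succ_iff.mpr hk⟩ : Fin (s + 1))) h
  exact (MemLp.toLp_eq_toLp_iff (y.memLp_deriv ⟨k, _⟩) (z.memLp_deriv ⟨k, _⟩)).1 hj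

/-- Functions with the same class in `W_p^s` have the same derivatives of order `k < s`, everywhere
on `[a, b]`. -/
theorem deriv_eqOn_of_mk_eq {y z : SobolevFun a b p s}
    (h : (SeparationQuotient.mk y : Sobolev a b p s) = SeparationQuotient.mk z)
    {k : ℕ} (hk : k < s) : EqOn (y.deriv k) (z.deriv k) (Icc a b) := by
  have hae := deriv_ae_eq_of_mk_eq h hk.le
  have hy := (y.mem.mono hab.out (k := k + 1) hk).1
  have hz := (z.mem.mono hab.out (k := k + 1) hk).1
  exact Measure.eqOn_Icc_of_ae_eq volume hab.out.ne hae
    (hy.continuousOn_iteratedDerivWithin le_rfl (uniqueDiffOn_Icc hab.out))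
    (hz.continuousOn_iteratedDerivWithin le_rfl (uniqueDiffOn_Icc hab.out))

theorem mk_rep (y : Sobolev a b p s) : SeparationQuotient.mk y.rep = y :=
  SeparationQuotient.mk_outCLM ℂ y

theorem deriv_add_ae (y z : Sobolev a b p s) {k : ℕ} (hk : k ≤ s) :
    (y + z).deriv k =ᵐ[volume.restrict (Icc a b)] y.deriv k + z.deriv k := by
  have : (y + z).rep = y.rep + z.rep := map_add _ _ _
  rw [deriv, this]
  exact SobolevFun.deriv_add_ae _ _ hk

theorem deriv_smul (c : ℂ) (y : Sobolev a b p s) (k : ℕ) :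
    (c • y).deriv k = c • y.deriv k := by
  have : (c • y).rep = c • y.rep := map_smul _ _ _
  rw [deriv, this]
  exact SobolevFun.deriv_smul _ _ _

end Sobolev

section BoundaryValueProblem

variable {a b : ℝ} [hab : Fact (a < b)] {p : ℝ≥0∞} [Fact (1 ≤ p)] {m n r l : ℕ}

/-- The function `(L y)_i (t) = y_i^(r)(t) + ∑_{q < r} ∑_j (A_q(t))_{ij} y_j^(q)(t)`. -/
noncomputable def diffExpr (A : Fin r → Matrix (Fin m) (Fin m) (Sobolev a b p n))
    (y : Fin m → Sobolev a b p (n + r)) (i : Fin m) : ℝ → ℂ :=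
  (y i).deriv r + ∑ q : Fin r, ∑ j : Fin m, (A q i j).deriv 0 * (y j).deriv q

theorem diffExpr_mem (A : Fin r → Matrix (Fin m) (Fin m) (Sobolev a b p n))
    (y : Fin m → Sobolev a b p (n + r)) (i : Fin m) :
    SobolevMem a b p n (diffExpr A y i) := by
  have h := hab.out
  refine SobolevMem.add h (SobolevMem.iteratedDeriv h (y i).rep.mem)
    (SobolevMem.finsetSum h _ fun q _ => SobolevMem.finsetSum h _ fun j _ =>
      SobolevMem.mul h ?_ ?_)
  · simpa [Sobolev.deriv, SobolevFun.deriv] using (A q i j).rep.mem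
  · exact SobolevMem.iteratedDeriv h ((y j).rep.mem.mono h (by omega))

/-- The differential operator `L : (W_p^(n+r))^m → (W_p^n)^m`,
`L y = y^(r) + A_{r-1} y^(r-1) + ⋯ + A_0 y`. -/
noncomputable def diffOp (A : Fin r → Matrix (Fin m) (Fin m) (Sobolev a b p n)) :
    (Fin m → Sobolev a b p (n + r)) →ₗ[ℂ] (Fin m → Sobolev a b p n) where
  toFun y i := SeparationQuotient.mk (SobolevFun.ofFun (diffExpr A y i) (diffExpr_mem A y i))
  map_add' y z := by
    ext1 i
    rw [Pi.add_apply, ← SeparationQuotient.mk_add]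
    refine Sobolev.mk_eq_of_ae ?_
    have h0 := Sobolev.deriv_add_ae (y i) (z i) (k := r) (by omega)
    have h1 : ∀ᵐ t ∂(volume.restrict (Icc a b)), ∀ (q : Fin r) (j : Fin m),
        (y j + z j).deriv q t = (y j).deriv q t + (z j).deriv q t :=
      ae_all_iff.2 fun q => ae_all_iff.2 fun j =>
        Sobolev.deriv_add_ae (y j) (z j) (k := q) (by omega)
    filter_upwards [h0, h1] with t ht0 ht1
    change diffExpr A (y + z) i t = diffExpr A y i t + diffExpr A z i t
    simp only [diffExpr, Pi.add_apply, Finset.sum_apply, Pi.mul_apply, ht0, ht1, mul_add,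
      Finset.sum_add_distrib]
    ring
  map_smul' c y := by
    ext1 i
    rw [Pi.smul_apply, ← SeparationQuotient.mk_smul]
    refine Sobolev.mk_eq_of_ae (ae_of_all _ fun t => ?_)
    change diffExpr A (c • y) i t = c • diffExpr A y i t
    simp only [diffExpr, Pi.add_apply, Finset.sum_apply, Pi.mul_apply, Pi.smul_apply,
      Sobolev.deriv_smul, smul_eq_mul, mul_add, Finset.mul_sum]
    congr 1
    refine Finset.sum_congr rfl fun q _ => Finset.sum_congr rfl fun j _ => ?_
    ring

/-- The operator `(L, B) : (W_p^(n+r))^m → (W_p^n)^m × ℂ^l` of the boundary-value problem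
`L y = f`, `B y = c`. -/
noncomputable def bvpOp (A : Fin r → Matrix (Fin m) (Fin m) (Sobolev a b p n))
    (B : (Fin m → Sobolev a b p (n + r)) →L[ℂ] (Fin l → ℂ)) :
    (Fin m → Sobolev a b p (n + r)) →ₗ[ℂ] (Fin m → Sobolev a b p n) × (Fin l → ℂ) :=
  (diffOp A).prod B.toLinearMap

/-- `Y ∈ (W_p^(n+r))^{m×m}` solves the `k`-th matrix Cauchy problem (`k = 0, …, r - 1`):
`Y^(r) + ∑_{q < r} A_q Y^(q) = O_m` on `(a, b)`, `Y^(j)(a) = δ_{k,j} I_m` for `j = 0, …, r - 1`.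
The equation, imposed on each column of `Y`, is an identity in `W_p^n`: almost everywhere for
`n = 0`, everywhere for `n ≥ 1`. -/
def IsCauchySolution (A : Fin r → Matrix (Fin m) (Fin m) (Sobolev a b p n)) (k : Fin r)
    (Y : Matrix (Fin m) (Fin m) (Sobolev a b p (n + r))) : Prop :=
  (∀ c : Fin m, diffOp A (fun i => Y i c) = 0) ∧
  ∀ (j : Fin r) (i c : Fin m),
    (Y i c).deriv j a = if j = k then (1 : Matrix (Fin m) (Fin m) ℂ) i c else 0

/-- The solution `Y_k` of the `k`-th matrix Cauchy problem. -/
noncomputable def cauchySolution (A : Fin r → Matrix (Fin m) (Fin m) (Sobolev a b p n))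
    (k : Fin r) : Matrix (Fin m) (Fin m) (Sobolev a b p (n + r)) :=
  Classical.epsilon (IsCauchySolution A k)

/-- The characteristic matrix `M(L, B) = ([B Y_0], …, [B Y_{r-1}]) ∈ ℂ^{l × mr}`: the column with
index `c` of the block `[B Y_k]` is the value of `B` at the column with index `c` of `Y_k`. -/
noncomputable def charMatrix (A : Fin r → Matrix (Fin m) (Fin m) (Sobolev a b p n))
    (B : (Fin m → Sobolev a b p (n + r)) →L[ℂ] (Fin l → ℂ)) :
    Matrix (Fin l) (Fin r × Fin m) ℂ :=
  Matrix.of fun i kc => B (fun j => cauchySolution A kc.1 j kc.2) i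

end BoundaryValueProblem

/-! ### Absolute continuity, and integral equations with an integrable Lipschitz constant -/

section AbsCont

variable {X Y : Type*} [PseudoMetricSpace X] [PseudoMetricSpace Y]

/-! Let `C y = (y(a), …, y^(r-1)(a))`. The pair `(L, C)`, called `cauchyOp A`, is a bounded
bijection from `(W_p^(n+r))^m` onto `(W_p^n)^m × ℂ^(rm)`. The Sobolev spaces are complete, so the
open mapping theorem makes it invertible. Each column of `Y_k` is the inverse of `(L, C)` applied to
data that do not depend on `L`; this gives unique solvability and reduces the limit to three facts.

Strong convergence of `L(k)` forces the coefficients to converge in `W_p^n`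
(`tendsto_coefficients`): on the vector with the single nonzero entry `(t - a)^q / q!` the operator
returns a column of `A_q` plus terms in `A_0, …, A_{q-1}` and a term free of coefficients, so
induction on `q` applies.

Multiplication `W_p^n × W_p^(n+1) → W_p^n` is a bounded bilinear map (`Sobolev.mulCLM`), so `(L, C)`
depends on the coefficients continuously in operator norm (`continuous_cauchyOp`). Inversion is
continuous at an invertible operator, hence the columns of `Y_k` converge in `(W_p^(n+r))^m`.

By Banach–Steinhaus the strongly convergent functionals `B(k)` are uniformly bounded, so they may be
evaluated along these convergent columns (`tendsto_clm_apply_of_tendsto`).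

Bijectivity of `(L, C)` is the Cauchy problem with coefficients that may be merely integrable. It is
rewritten as an integral equation for `(y, …, y^(r-1))`, solved by a contraction in a weighted sup
norm, with uniqueness by Grönwall; a bootstrap then shows that the solution has the full order `n +
r`. -/

theorem AbsolutelyContinuousOnInterval.of_dist_le {f : ℝ → X} {g : ℝ → Y} {a b C : ℝ}
    (hg : AbsolutelyContinuousOnInterval g a b)
    (h : ∀ x ∈ uIcc a b, ∀ y ∈ uIcc a b, dist (f x) (f y) ≤ C * dist (g x) (g y)) :
    AbsolutelyContinuousOnInterval f a b := by
  rw [absolutelyContinuousOnInterval_iff] at hg ⊢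
  intro ε hε
  -- No sign is assumed for `C`; `|C| + 1` is a positive upper bound for it.
  obtain ⟨δ, hδ, H⟩ := hg (ε / (|C| + 1)) (by positivity)
  refine ⟨δ, hδ, fun E hE hl => ?_⟩
  have h1 := H E hE hl
  rw [lt_div_iff₀ (by positivity)] at h1
  refine lt_of_le_of_lt ?_ h1
  rw [Finset.sum_mul]
  refine Finset.sum_le_sum fun i hi => ?_
  have hm := hE.1 i hi
  refine (h _ hm.1 _ hm.2).trans ?_
  rw [mul_comm]
  exact mul_le_mul_of_nonneg_left ((le_abs_self C).trans (by linarith)) dist_nonneg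

variable {E : Type*} [NormedAddCommGroup E] [NormedSpace ℝ E]

/-- Transfers absolute continuity to a vector-valued primitive from the scalar primitive of a
majorant; the factor `1` matches the constant in `AbsolutelyContinuousOnInterval.of_dist_le`. -/
theorem dist_intervalIntegral_le {f : ℝ → E} {κ : ℝ → ℝ} {a b : ℝ}
    (hf : IntervalIntegrable f volume a b) (hκ : IntervalIntegrable κ volume a b)
    (hle : ∀ t ∈ uIcc a b, ‖f t‖ ≤ κ t) :
    ∀ x ∈ uIcc a b, ∀ y ∈ uIcc a b,
      dist (∫ v in a..x, f v) (∫ v in a..y, f v) ≤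
        1 * dist (∫ v in a..x, κ v) (∫ v in a..y, κ v) := by
  intro x hx y hy
  have sub : ∀ u ∈ uIcc a b, uIcc a u ⊆ uIcc a b := fun u hu => uIcc_subset_uIcc_left hu
  rw [dist_eq_norm, dist_eq_norm, one_mul,
    intervalIntegral.integral_interval_sub_left (hf.mono_set (sub x hx)) (hf.mono_set (sub y hy)),
    intervalIntegral.integral_interval_sub_left (hκ.mono_set (sub x hx)) (hκ.mono_set (sub y hy)),
    Real.norm_eq_abs]
  have hyx : uIcc y x ⊆ uIcc a b := uIcc_subset_uIcc hy hx
  refine intervalIntegral.norm_integral_le_abs_of_norm_le ?_ (hκ.mono_set hyx)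
  refine (ae_restrict_mem measurableSet_uIoc).mono fun t ht => hle t (hyx (uIoc_subset_uIcc ht))

theorem IntervalIntegrable.absolutelyContinuousOnInterval_integral {f : ℝ → E} {a b : ℝ}
    (hf : IntervalIntegrable f volume a b) :
    AbsolutelyContinuousOnInterval (fun x => ∫ v in a..x, f v) a b :=
  (hf.norm.absolutelyContinuousOnInterval_intervalIntegral left_mem_uIcc).of_dist_le
    (dist_intervalIntegral_le hf hf.norm fun _ _ => le_rfl)

/-- The fundamental theorem of calculus for absolutely continuous functions. -/
theorem AbsolutelyContinuousOnInterval.eq_add_integral [CompleteSpace E] {f g : ℝ → E} {a b : ℝ}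
    (hf : AbsolutelyContinuousOnInterval f a b) (hg : IntervalIntegrable g volume a b)
    (hd : ∀ᵐ t, t ∈ uIcc a b → HasDerivAt f (g t) t) {t : ℝ} (ht : t ∈ uIcc a b) :
    f t = f a + ∫ v in a..t, g v := by
  -- The difference `f - ∫ g` is absolutely continuous with derivative zero almost everywhere, hence
  -- constant.
  obtain ⟨C, hC⟩ := (hf.fun_sub hg.absolutelyContinuousOnInterval_integral
    ).const_of_ae_hasDerivAt_zero (by
      filter_upwards [hd, hg.ae_hasDerivAt_integral] with x h1 h2 hx
      have h3 := (h1 hx).sub (h2 hx a left_mem_uIcc)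
      rwa [sub_self] at h3)
  have h1 := hC t ht
  have h2 := hC a left_mem_uIcc
  simp only [intervalIntegral.integral_same, sub_zero] at h2
  rw [h2, ← h1]; abel

/-- `∫ κ e^{2μ} = (e^{2μ} - 1) / 2` for `μ = ∫ κ`. -/
theorem integral_mul_exp_integral {κ : ℝ → ℝ} {a b : ℝ}
    (hκ : IntervalIntegrable κ volume a b) {t : ℝ} (ht : t ∈ uIcc a b) :
    ∫ s in a..t, κ s * Real.exp (2 * ∫ v in a..s, κ v) =
      (Real.exp (2 * ∫ v in a..t, κ v) - 1) / 2 := by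
  have hac := hκ.absolutelyContinuousOnInterval_integral
  have hcont : ContinuousOn (fun s => ∫ v in a..s, κ v) (uIcc a b) := hac.continuousOn
  obtain ⟨K, hK⟩ := hac.exists_bound
  have hexp : AbsolutelyContinuousOnInterval
      (fun s => Real.exp (2 * ∫ v in a..s, κ v) / 2) a b := by
    -- The primitive of `κ` takes its values in `[-K, K]`, where the exponential is Lipschitz, so
    -- the composition is absolutely continuous. This is what permits integrating a derivative that
    -- exists only almost everywhere.
    have hl : ContDiffOn ℝ 1 (fun x : ℝ => Real.exp (2 * x) / 2) (Icc (-K) K) := by fun_prop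
    obtain ⟨C, hC⟩ := hl.exists_lipschitzOnWith (by decide) (convex_Icc _ _) isCompact_Icc
    refine hac.of_dist_le (C := C) fun x hx y hy => ?_
    have hmem : ∀ u ∈ uIcc a b, (∫ v in a..u, κ v) ∈ Icc (-K) K := fun u hu =>
      abs_le.1 (hK u hu)
    exact hC.dist_le_mul _ (hmem x hx) _ (hmem y hy)
  have h := hexp.eq_add_integral
    (g := fun s => κ s * Real.exp (2 * ∫ v in a..s, κ v))
    (hκ.mul_continuousOn (by fun_prop)) (by
      filter_upwards [hκ.ae_hasDerivAt_integral] with x h2 hx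
      exact ((((h2 hx a left_mem_uIcc).const_mul 2).exp).div_const 2).congr_deriv (by ring)) ht
  simp only [intervalIntegral.integral_same, mul_zero, Real.exp_zero] at h
  linarith


/-- A continuous map that solves `v = v₀ + ∫ F(s, v(s)) ds` exists when `F` is Lipschitz in the
second variable with an integrable constant `κ`. -/
theorem exists_eq_add_integral [CompleteSpace E] {F : ℝ → E → E} {κ : ℝ → ℝ} {a b : ℝ}
    (hab : a ≤ b) (hκ : IntervalIntegrable κ volume a b) (hκ0 : ∀ t ∈ Icc a b, 0 ≤ κ t)
    (hlip : ∀ t ∈ Icc a b, ∀ x y, ‖F t x - F t y‖ ≤ κ t * ‖x - y‖)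
    (hint : ∀ v : ℝ → E, ContinuousOn v (Icc a b) →
      IntervalIntegrable (fun t => F t (v t)) volume a b) (v₀ : E) :
    ∃ v : ℝ → E, ContinuousOn v (Icc a b) ∧
      ∀ t ∈ Icc a b, v t = v₀ + ∫ s in a..t, F s (v s) := by
  have hu : uIcc a b = Icc a b := uIcc_of_le hab
  -- The weight of a Bielecki norm. The factor `2` makes `∫ κ w = (w - 1) / 2`, which yields the
  -- contraction constant `1 / 2` without subdividing the interval.
  set w : ℝ → ℝ := fun t => Real.exp (2 * ∫ v in a..t, κ v) with hw
  have hwpos : ∀ t, 0 < w t := fun t => Real.exp_pos _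
  have hμ : ContinuousOn (fun s => ∫ v in a..s, κ v) (Icc a b) :=
    hu ▸ hκ.absolutelyContinuousOnInterval_integral.continuousOn
  have hwc : ContinuousOn w (Icc a b) := by fun_prop
  have hwi : ContinuousOn (fun t => (w t)⁻¹) (Icc a b) := hwc.inv₀ fun t _ => (hwpos t).ne'
  have hlift : ∀ u : C(Icc a b, E), ContinuousOn (fun s => w s • IccExtend hab u s) (Icc a b) :=
    fun u => hwc.smul u.continuous.Icc_extend'.continuousOn
  have hI : ∀ u : C(Icc a b, E), IntervalIntegrable
      (fun s => F s (w s • IccExtend hab u s)) volume a b := fun u => hint _ (hlift u)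
  have hc : ∀ u : C(Icc a b, E), ContinuousOn (fun t => (w t)⁻¹ • (v₀ + ∫ s in a..t,
      F s (w s • IccExtend hab u s))) (Icc a b) := fun u =>
    hwi.smul (continuousOn_const.add (by
      have := (hI u).absolutelyContinuousOnInterval_integral.continuousOn
      rwa [hu] at this))
  -- The unknown is `u = v / w`, so that the ordinary sup norm of `u` is the weighted norm of `v`.
  let T : C(Icc a b, E) → C(Icc a b, E) := fun u => ⟨_, (hc u).domRestrict⟩
  have hT : ContractingWith (1 / 2) T := by
    refine ⟨by rw [← NNReal.coe_lt_coe]; norm_num, LipschitzWith.of_dist_le_mul fun u u' => ?_⟩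
    rw [ContinuousMap.dist_le (by positivity)]
    intro t
    have ht : t.1 ∈ uIcc a b := by rw [hu]; exact t.2
    have hsub : uIcc a t.1 ⊆ uIcc a b := uIcc_subset_uIcc_left ht
    change dist ((w t)⁻¹ • (v₀ + ∫ s in a..t, F s (w s • IccExtend hab u s)))
      ((w t)⁻¹ • (v₀ + ∫ s in a..t, F s (w s • IccExtend hab u' s))) ≤ _
    rw [dist_smul₀, dist_add_left, dist_eq_norm, ← intervalIntegral.integral_sub
      ((hI u).mono_set hsub) ((hI u').mono_set hsub)]
    have hle : ‖∫ s in a..t, (F s (w s • IccExtend hab u s) - F s (w s • IccExtend hab u' s))‖ ≤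
        ∫ s in a..t, (κ s * w s) * dist u u' := by
      refine intervalIntegral.norm_integral_le_of_norm_le t.2.1 ?_ ?_
      · refine ae_of_all _ fun s hs => ?_
        have hs' : s ∈ Icc a b := ⟨hs.1.le, hs.2.trans t.2.2⟩
        refine (hlip s hs' _ _).trans ?_
        rw [← smul_sub, norm_smul, Real.norm_of_nonneg (hwpos s).le, ← mul_assoc]
        refine mul_le_mul_of_nonneg_left ?_ (mul_nonneg (hκ0 s hs') (hwpos s).le)
        rw [← dist_eq_norm]
        exact ContinuousMap.dist_apply_le_dist _
      · exact ((hκ.mul_continuousOn (hu ▸ hwc)).mono_set hsub).mul_const _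
    rw [intervalIntegral.integral_mul_const,
      integral_mul_exp_integral hκ ht] at hle
    rw [norm_inv, Real.norm_of_nonneg (hwpos t).le, inv_mul_le_iff₀ (hwpos t)]
    refine hle.trans ?_
    have hd : 0 ≤ dist u u' := dist_nonneg
    have h2 : ((1 / 2 : NNReal) : ℝ) = 1 / 2 := by norm_num
    rw [h2]
    change (w t - 1) / 2 * dist u u' ≤ w t * (1 / 2 * dist u u')
    nlinarith
  refine ⟨fun t => w t • IccExtend hab hT.fixedPoint t, hlift _, fun t ht => ?_⟩
  have hfix : T hT.fixedPoint = hT.fixedPoint := hT.fixedPoint_isFixedPt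
  have h1 := congrArg (fun u : C(Icc a b, E) => u ⟨t, ht⟩) hfix
  change (w t)⁻¹ • (v₀ + ∫ s in a..t, F s (w s • IccExtend hab hT.fixedPoint s)) = _ at h1
  change w t • IccExtend hab hT.fixedPoint t = _
  rw [IccExtend_of_mem hab _ ht, ← h1, smul_inv_smul₀ (hwpos t).ne']

end AbsCont

/-- Grönwall's lemma in integral form: `‖z(t)‖ ≤ ∫ κ ‖z‖` forces `z = 0`. -/
theorem eq_zero_of_norm_le_integral {E : Type*} [NormedAddCommGroup E] {z : ℝ → E} {κ : ℝ → ℝ} {a b : ℝ}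
    (hab : a ≤ b) (hκ : IntervalIntegrable κ volume a b) (hκ0 : ∀ t ∈ Icc a b, 0 ≤ κ t)
    (hz : ContinuousOn z (Icc a b))
    (hle : ∀ t ∈ Icc a b, ‖z t‖ ≤ ∫ s in a..t, κ s * ‖z s‖) : ∀ t ∈ Icc a b, z t = 0 := by
  have hu : uIcc a b = Icc a b := uIcc_of_le hab
  set w : ℝ → ℝ := fun t => Real.exp (2 * ∫ v in a..t, κ v) with hw
  have hwpos : ∀ t, 0 < w t := fun t => Real.exp_pos _
  have hμ : ContinuousOn (fun s => ∫ v in a..s, κ v) (Icc a b) :=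
    hu ▸ hκ.absolutelyContinuousOnInterval_integral.continuousOn
  have hwc : ContinuousOn w (Icc a b) := by fun_prop
  -- At a maximum point of `‖z‖ / w`, with maximum `S`, the hypothesis gives `S w(t₀) ≤ S (w(t₀) -
  -- 1) / 2`, which forces `S = 0`.
  obtain ⟨t₀, ht₀, hmax⟩ := isCompact_Icc.exists_isMaxOn (nonempty_Icc.2 hab)
    (hz.norm.div hwc fun t _ => (hwpos t).ne')
  set S := ‖z t₀‖ / w t₀ with hS
  have hS0 : 0 ≤ S := div_nonneg (norm_nonneg _) (hwpos _).le
  have hzS : ∀ t ∈ Icc a b, ‖z t‖ ≤ S * w t := fun t ht => by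
    rw [← div_le_iff₀ (hwpos t)]; exact hmax ht
  have hsub : uIcc a t₀ ⊆ uIcc a b := uIcc_subset_uIcc_left (hu ▸ ht₀)
  have h1 : ∫ s in a..t₀, κ s * ‖z s‖ ≤ ∫ s in a..t₀, (κ s * w s) * S := by
    refine intervalIntegral.integral_mono_on ht₀.1
      ((hκ.mul_continuousOn (hu ▸ hz.norm)).mono_set hsub)
      (((hκ.mul_continuousOn (hu ▸ hwc)).mono_set hsub).mul_const _) fun s hs => ?_
    have hs' : s ∈ Icc a b := ⟨hs.1, hs.2.trans ht₀.2⟩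
    rw [mul_assoc, mul_comm (w s)]
    exact mul_le_mul_of_nonneg_left (hzS s hs') (hκ0 s hs')
  rw [intervalIntegral.integral_mul_const, integral_mul_exp_integral hκ (hu ▸ ht₀)] at h1
  have h2 : S * w t₀ ≤ (w t₀ - 1) / 2 * S := by
    have : S * w t₀ = ‖z t₀‖ := div_mul_cancel₀ _ (hwpos _).ne'
    rw [this]
    exact (hle t₀ ht₀).trans h1
  have hS' : S = 0 := by
    have := hwpos t₀
    nlinarith
  intro t ht
  have := hzS t ht
  rw [hS', zero_mul] at this
  exact norm_le_zero_iff.1 this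

/-! ### Functions of class `W_p^s`: primitives, products, a sup bound -/

section SobolevFunctions

variable {a b : ℝ} {p : ℝ≥0∞} {s : ℕ} {y z g : ℝ → ℂ}

theorem MeasureTheory.MemLp.intervalIntegrable_Icc (hp : 1 ≤ p) (hab : a < b)
    (h : MemLp y p (volume.restrict (Icc a b))) : IntervalIntegrable y volume a b := by
  rw [intervalIntegrable_iff_integrableOn_Icc_of_le hab.le]
  exact h.integrable hp

theorem SobolevMem.intervalIntegrable (hp : 1 ≤ p) (hab : a < b) (h : SobolevMem a b p s y) :
    IntervalIntegrable y volume a b :=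
  MemLp.intervalIntegrable_Icc hp hab (by simpa using h.memLp hab (Nat.zero_le s))

theorem AbsolutelyContinuousOnInterval.ae_hasDerivAt_derivWithin (hab : a < b)
    (h : AbsolutelyContinuousOnInterval y a b) :
    ∀ᵐ t, t ∈ uIcc a b → HasDerivAt y (derivWithin y (Icc a b) t) t := by
  filter_upwards [h.boundedVariationOn.ae_differentiableAt_of_mem_uIcc] with t ht hm
  have hd := ht hm
  rw [uIcc_of_le hab.le] at hm
  rw [hd.derivWithin (uniqueDiffOn_Icc hab t hm)]
  exact hd.hasDerivAt

theorem SobolevMem.congr (hab : a < b) (h : SobolevMem a b p s y) (hyz : EqOn y z (Icc a b)) :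
    SobolevMem a b p s z := by
  have hd : ∀ k, EqOn (iteratedDerivWithin k y (Icc a b)) (iteratedDerivWithin k z (Icc a b))
    (Icc a b) := fun k => iteratedDerivWithin_congr hyz
  have hae : ∀ k, iteratedDerivWithin k y (Icc a b) =ᵐ[volume.restrict (Icc a b)]
      iteratedDerivWithin k z (Icc a b) := fun k =>
    (ae_restrict_mem measurableSet_Icc).mono fun t ht => hd k ht
  cases s with
  | zero => exact MemLp.ae_eq (by simpa using hae 0) h
  | succ s => exact ⟨h.1.congr hyz.symm, h.2.1.congr_Icc hab (hd s), h.2.2.ae_eq (hae _)⟩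

theorem SobolevMem.continuousOn (h : SobolevMem a b p (s + 1) y) : ContinuousOn y (Icc a b) :=
  h.1.continuousOn

theorem SobolevMem.eq_add_integral (hp : 1 ≤ p) (hab : a < b) (h : SobolevMem a b p (s + 1) y)
    {t : ℝ} (ht : t ∈ Icc a b) : y t = y a + ∫ v in a..t, derivWithin y (Icc a b) v := by
  have h1 := h.mono hab (k := 1) (by omega)
  have hac : AbsolutelyContinuousOnInterval y a b := by simpa using h1.2.1
  refine hac.eq_add_integral (MemLp.intervalIntegrable_Icc hp hab (by simpa using h1.2.2))
    (hac.ae_hasDerivAt_derivWithin hab) ?_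
  rwa [uIcc_of_le hab.le]

theorem SobolevMem.derivWithin (hab : a < b) (h : SobolevMem a b p (s + 1) y) :
    SobolevMem a b p s (derivWithin y (Icc a b)) := by
  simpa using SobolevMem.iteratedDeriv hab (q := 1) h

/-- Extending `g` by constants beyond the end points makes it continuous on the line, so the
classical fundamental theorem covers the end points as well. -/
theorem hasDerivWithinAt_of_eq_add_integral (hab : a < b) {c : ℂ} (hg : ContinuousOn g (Icc a b))
    (hz : ∀ t ∈ Icc a b, z t = c + ∫ v in a..t, g v) {t : ℝ} (ht : t ∈ Icc a b) :
    HasDerivWithinAt z (g t) (Icc a b) t := by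
  have hG : Continuous (IccExtend hab.le (domRestrict (Icc a b) g)) := hg.domRestrict.Icc_extend'
  have hGg : ∀ x ∈ Icc a b, IccExtend hab.le (domRestrict (Icc a b) g) x = g x := fun x hx => by
    rw [IccExtend_of_mem hab.le _ hx]; rfl
  have h1 := ((hG.integral_hasStrictDerivAt a t).hasDerivAt.const_add c).hasDerivWithinAt
    (s := Icc a b)
  rw [hGg t ht] at h1
  refine h1.congr_of_mem (fun x hx => ?_) ht
  rw [hz x hx]
  congr 1
  refine intervalIntegral.integral_congr fun v hv => ?_
  rw [uIcc_of_le hx.1] at hv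
  exact (hGg v ⟨hv.1, hv.2.trans hx.2⟩).symm

theorem AbsolutelyContinuousOnInterval.of_eq_add_integral (hab : a < b) {c : ℂ}
    (hg : IntervalIntegrable g volume a b)
    (hz : ∀ t ∈ Icc a b, z t = c + ∫ v in a..t, g v) : AbsolutelyContinuousOnInterval z a b := by
  refine hg.absolutelyContinuousOnInterval_integral.of_dist_le (C := 1) fun x hx y hy => ?_
  rw [uIcc_of_le hab.le] at hx hy
  rw [hz x hx, hz y hy, dist_add_left, one_mul]

theorem derivWithin_ae_eq_of_eq_add_integral (hab : a < b) {c : ℂ}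
    (hg : IntervalIntegrable g volume a b)
    (hz : ∀ t ∈ Icc a b, z t = c + ∫ v in a..t, g v) :
    derivWithin z (Icc a b) =ᵐ[volume.restrict (Icc a b)] g := by
  rw [EventuallyEq, ae_restrict_iff' measurableSet_Icc]
  filter_upwards [hg.ae_hasDerivAt_integral] with t h1 ht
  have h2 := ((h1 (by rwa [uIcc_of_le hab.le]) a left_mem_uIcc).const_add c).hasDerivWithinAt
    (s := Icc a b)
  exact (h2.congr_of_mem hz ht).derivWithin (uniqueDiffOn_Icc hab t ht)

/-- A primitive of a function of class `W_p^s` is of class `W_p^(s+1)`. -/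
theorem SobolevMem.of_eq_add_integral (hp : 1 ≤ p) (hab : a < b) {c : ℂ}
    (hg : SobolevMem a b p s g) (hz : ∀ t ∈ Icc a b, z t = c + ∫ v in a..t, g v) :
    SobolevMem a b p (s + 1) z := by
  have hI := hg.intervalIntegrable hp hab
  have hac := AbsolutelyContinuousOnInterval.of_eq_add_integral hab hI hz
  cases s with
  | zero =>
    refine ⟨?_, by simpa using hac, ?_⟩
    · have := hac.continuousOn
      rw [uIcc_of_le hab.le] at this
      simpa using this
    · refine MemLp.ae_eq (f := g) ?_ hg
      simpa using (derivWithin_ae_eq_of_eq_add_integral hab hI hz).symm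
  | succ s =>
    -- From `s + 1` on, `g` is continuous, so `z' = g` at every point of `[a, b]` and the smoothness
    -- of `g` passes to `z'` directly.
    have hd := fun t ht => hasDerivWithinAt_of_eq_add_integral hab hg.continuousOn hz (t := t) ht
    have hu := uniqueDiffOn_Icc hab
    have he : EqOn (_root_.derivWithin z (Icc a b)) g (Icc a b) := fun t ht =>
      (hd t ht).derivWithin (hu t ht)
    have h1 : SobolevMem a b p (s + 1) (_root_.derivWithin z (Icc a b)) := hg.congr hab he.symm
    refine ⟨?_, ?_, ?_⟩
    · have := (contDiffOn_succ_iff_derivWithin (n := (s : WithTop ℕ∞)) hu).2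
        ⟨fun t ht => (hd t ht).differentiableWithinAt, by simp, h1.1⟩
      exact_mod_cast this
    · rw [iteratedDerivWithin_succ']; exact h1.2.1
    · rw [iteratedDerivWithin_succ']; exact h1.2.2

/-- For `s ≥ 1` the space `W_p^s` is closed under multiplication. -/
theorem SobolevMem.mul_self (hp : 1 ≤ p) (hab : a < b) (hy : SobolevMem a b p (s + 1) y)
    (hz : SobolevMem a b p (s + 1) z) : SobolevMem a b p (s + 1) (y * z) := by
  have hac : ∀ {u : ℝ → ℂ}, SobolevMem a b p (s + 1) u → AbsolutelyContinuousOnInterval u a b :=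
    fun hu => by simpa using hu.absolutelyContinuous hab (Nat.zero_le s)
  -- The product is a primitive of `y' z + z' y`, and each term pairs a factor of order `s` with one
  -- of order `s + 1`.
  have hg : SobolevMem a b p s (_root_.derivWithin y (Icc a b) * z +
      _root_.derivWithin z (Icc a b) * y) :=
    (hy.derivWithin hab |>.mul hab hz).add hab (hz.derivWithin hab |>.mul hab hy)
  refine SobolevMem.of_eq_add_integral hp hab hg fun t ht =>
    ((hac hy).smul (hac hz)).eq_add_integral (hg.intervalIntegrable hp hab) ?_
      (by rwa [uIcc_of_le hab.le])
  filter_upwards [(hac hy).ae_hasDerivAt_derivWithin hab,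
    (hac hz).ae_hasDerivAt_derivWithin hab] with t h1 h2 ht
  refine ((h1 ht).mul (h2 ht)).congr_deriv ?_
  simp only [Pi.add_apply, Pi.mul_apply]
  ring

/-- For every `x` one has `‖y t‖ ≤ ‖y x‖ + ∫ ‖y'‖`; averaging over `x` replaces the unknown value by
the mean of `‖y‖`. -/
theorem SobolevMem.norm_le (hp : 1 ≤ p) (hab : a < b) (h : SobolevMem a b p 1 y) {t : ℝ}
    (ht : t ∈ Icc a b) :
    ‖y t‖ ≤ (b - a)⁻¹ * (∫ v in Icc a b, ‖y v‖) +
      ∫ v in Icc a b, ‖_root_.derivWithin y (Icc a b) v‖ := by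
  set d := _root_.derivWithin y (Icc a b)
  have hd : IntervalIntegrable d volume a b := (h.derivWithin hab).intervalIntegrable hp hab
  have hyI : IntegrableOn y (Icc a b) := h.continuousOn.integrableOn_Icc
  have hdI : IntegrableOn d (Icc a b) :=
    (intervalIntegrable_iff_integrableOn_Icc_of_le hab.le).1 hd
  set D := ∫ v in Icc a b, ‖d v‖
  have key : ∀ x ∈ Icc a b, ‖y t‖ - D ≤ ‖y x‖ := fun x hx => by
    have hsub : ∀ u ∈ Icc a b, IntervalIntegrable d volume a u := fun u hu =>
      hd.mono_set (uIcc_subset_uIcc_left (by rwa [uIcc_of_le hab.le]))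
    have h1 : y t - y x = ∫ v in x..t, d v := by
      rw [h.eq_add_integral hp hab ht, h.eq_add_integral hp hab hx, add_sub_add_left_eq_sub,
        intervalIntegral.integral_interval_sub_left (hsub t ht) (hsub x hx)]
    have h2 : ‖∫ v in x..t, d v‖ ≤ D :=
      intervalIntegral.norm_integral_le_integral_norm_uIoc.trans
        (setIntegral_mono_set hdI.norm (ae_of_all _ fun _ => norm_nonneg _)
          (LE.le.eventuallyLE
            (uIoc_subset_uIcc.trans (by rw [← uIcc_of_le hab.le] at hx ht ⊢; exact uIcc_subset_uIcc hx ht))))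
    rw [← h1] at h2
    have := norm_sub_norm_le (y t) (y x)
    linarith
  have h3 : ∫ _ in Icc a b, (‖y t‖ - D) ≤ ∫ v in Icc a b, ‖y v‖ :=
    setIntegral_mono_on (by simp) hyI.norm measurableSet_Icc key
  have hpos : 0 < b - a := sub_pos.2 hab
  rw [setIntegral_const, Real.volume_real_Icc_of_le hab.le, smul_eq_mul] at h3
  have : ‖y t‖ - D ≤ (b - a)⁻¹ * ∫ v in Icc a b, ‖y v‖ := by
    rwa [le_inv_mul_iff₀ hpos]
  linarith

end SobolevFunctions

/-! ### The spaces `W_p^s`: differentiation, multiplication, completeness -/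

namespace Sobolev

variable {a b : ℝ} [hab : Fact (a < b)] {p : ℝ≥0∞} [hp : Fact (1 ≤ p)] {s t q k : ℕ}

/-- The element of `W_p^s` given by a function of class `W_p^s`. -/
noncomputable def mkFun (y : ℝ → ℂ) (hy : SobolevMem a b p s y) : Sobolev a b p s :=
  SeparationQuotient.mk (SobolevFun.ofFun y hy)

theorem deriv_mkFun_ae {y : ℝ → ℂ} (hy : SobolevMem a b p s y) (hk : k ≤ s) :
    (mkFun y hy).deriv k =ᵐ[volume.restrict (Icc a b)] iteratedDerivWithin k y (Icc a b) :=
  deriv_ae_eq_of_mk_eq (mk_rep _) hk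

theorem deriv_mkFun_zero_ae {y : ℝ → ℂ} (hy : SobolevMem a b p s y) :
    (mkFun y hy).deriv 0 =ᵐ[volume.restrict (Icc a b)] y := by
  simpa using deriv_mkFun_ae hy (Nat.zero_le s)

theorem deriv_mkFun_eqOn {y : ℝ → ℂ} (hy : SobolevMem a b p s y) (hk : k < s) :
    EqOn ((mkFun y hy).deriv k) (iteratedDerivWithin k y (Icc a b)) (Icc a b) :=
  deriv_eqOn_of_mk_eq (mk_rep _) hk

theorem mkFun_congr {y z : ℝ → ℂ} (hy : SobolevMem a b p s y) (hz : SobolevMem a b p s z)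
    (h : y =ᵐ[volume.restrict (Icc a b)] z) : mkFun y hy = mkFun z hz :=
  mk_eq_of_ae h

theorem deriv_zero (y : Sobolev a b p s) : y.deriv 0 = y.rep.toFun := iteratedDerivWithin_zero

theorem mkFun_deriv_zero (y : Sobolev a b p s) (h : SobolevMem a b p s (y.deriv 0)) :
    mkFun (y.deriv 0) h = y := by
  refine Eq.trans (mk_eq_of_ae ?_) (mk_rep y)
  exact Eq.eventuallyEq (deriv_zero y)

theorem mkFun_eq_iff {y : ℝ → ℂ} (hy : SobolevMem a b p s y) {z : Sobolev a b p s} :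
    mkFun y hy = z ↔ y =ᵐ[volume.restrict (Icc a b)] z.deriv 0 := by
  constructor
  · rintro rfl
    simpa using (deriv_mkFun_ae hy (Nat.zero_le s)).symm
  · intro h
    have hz : SobolevMem a b p s (z.deriv 0) := by rw [deriv_zero]; exact z.rep.mem
    exact (mkFun_congr hy hz h).trans (mkFun_deriv_zero z hz)

/-- Reduces identities in `W_p^s` to almost everywhere identities of the functions themselves: the
derivatives up to order `s` then agree automatically. -/
theorem ext_ae {y z : Sobolev a b p s}
    (h : y.deriv 0 =ᵐ[volume.restrict (Icc a b)] z.deriv 0) : y = z := by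
  have hy : SobolevMem a b p s (y.deriv 0) := by rw [deriv_zero]; exact y.rep.mem
  rw [← mkFun_deriv_zero y hy, mkFun_eq_iff]
  exact h

theorem deriv_mem (y : Sobolev a b p s) (h : t + q ≤ s) : SobolevMem a b p t (y.deriv q) :=
  SobolevMem.iteratedDeriv hab.out (y.rep.mem.mono hab.out h)

theorem deriv_zero_mem (y : Sobolev a b p s) : SobolevMem a b p s (y.deriv 0) := y.deriv_mem le_rfl

theorem derivWithin_deriv (y : Sobolev a b p s) (k : ℕ) :
    derivWithin (y.deriv k) (Icc a b) = y.deriv (k + 1) :=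
  iteratedDerivWithin_succ.symm

theorem memLp_deriv (y : Sobolev a b p s) (hk : k ≤ s) :
    MemLp (y.deriv k) p (volume.restrict (Icc a b)) :=
  y.rep.mem.memLp hab.out hk

theorem deriv_zero_add (y z : Sobolev a b p s) : (y + z).deriv 0 = y.deriv 0 + z.deriv 0 := by
  have : (y + z).rep = y.rep + z.rep := map_add _ _ _
  rw [deriv_zero, deriv_zero, deriv_zero, this]
  rfl

theorem norm_eq (y : Sobolev a b p s) :
    ‖y‖ = ∑ k ∈ Finset.range (s + 1),
      (eLpNorm (y.deriv k) p (volume.restrict (Icc a b))).toReal := by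
  conv_lhs => rw [← mk_rep y]
  rw [SeparationQuotient.norm_mk, SobolevFun.norm_def, Finset.sum_range]
  rfl

theorem norm_mkFun {y : ℝ → ℂ} (hy : SobolevMem a b p s y) :
    ‖mkFun y hy‖ = ∑ k ∈ Finset.range (s + 1),
      (eLpNorm (iteratedDerivWithin k y (Icc a b)) p (volume.restrict (Icc a b))).toReal := by
  rw [norm_eq]
  refine Finset.sum_congr rfl fun k hk => ?_
  rw [eLpNorm_congr_ae (deriv_mkFun_ae hy (Nat.lt_succ_iff.1 (Finset.mem_range.1 hk)))]

theorem eLpNorm_deriv_le (y : Sobolev a b p s) (hk : k ≤ s) :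
    (eLpNorm (y.deriv k) p (volume.restrict (Icc a b))).toReal ≤ ‖y‖ := by
  rw [norm_eq]
  exact Finset.single_le_sum (f := fun k =>
    (eLpNorm (y.deriv k) p (volume.restrict (Icc a b))).toReal)
    (fun _ _ => ENNReal.toReal_nonneg) (Finset.mem_range.2 (Nat.lt_succ_iff.2 hk))

/-- Differentiation of order `q`, as a bounded operator `W_p^s → W_p^t` where `t + q ≤ s`. -/
noncomputable def derivCLM (h : t + q ≤ s) : Sobolev a b p s →L[ℂ] Sobolev a b p t :=
  LinearMap.mkContinuous
    { toFun := fun y => mkFun (y.deriv q) (y.deriv_mem h)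
      map_add' := fun y z => by
        rw [mkFun_eq_iff, deriv_zero_add]
        refine (deriv_add_ae y z (by omega)).trans ?_
        exact ((deriv_mkFun_zero_ae (y.deriv_mem h)).add
          (deriv_mkFun_zero_ae (z.deriv_mem h))).symm
      map_smul' := fun c y => by
        rw [mkFun_eq_iff, deriv_smul, deriv_smul]
        exact ((deriv_mkFun_zero_ae (y.deriv_mem h)).const_smul c).symm } 1
    fun y => by
      rw [one_mul]
      change ‖mkFun (y.deriv q) (y.deriv_mem h)‖ ≤ _
      rw [norm_mkFun, norm_eq]
      have : ∀ k, iteratedDerivWithin k (y.deriv q) (Icc a b) = y.deriv (k + q) :=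
        fun k => iteratedDerivWithin_iteratedDerivWithin _ _ _ _
      simp only [this]
      -- The norm of `y^(q)` is the part of the sum for `‖y‖` over the orders `q, …, t + q`, and `t
      -- + q ≤ s`.
      rw [Finset.range_eq_Ico, Finset.sum_Ico_add' (fun k =>
        (eLpNorm (y.deriv k) p (volume.restrict (Icc a b))).toReal)]
      refine Finset.sum_le_sum_of_subset_of_nonneg (fun k hk => ?_)
        fun _ _ _ => ENNReal.toReal_nonneg
      rw [Finset.mem_Ico] at hk
      rw [Finset.mem_range]
      omega

theorem deriv_derivCLM_ae (h : t + q ≤ s) (y : Sobolev a b p s) (hk : k ≤ t) :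
    (derivCLM h y).deriv k =ᵐ[volume.restrict (Icc a b)] y.deriv (k + q) := by
  refine (deriv_mkFun_ae (y.deriv_mem h) hk).trans ?_
  rw [deriv, SobolevFun.deriv, iteratedDerivWithin_iteratedDerivWithin]
  rfl

theorem deriv_derivCLM_eqOn (h : t + q ≤ s) (y : Sobolev a b p s) (hk : k < t) :
    EqOn ((derivCLM h y).deriv k) (y.deriv (k + q)) (Icc a b) := by
  refine (deriv_mkFun_eqOn (y.deriv_mem h) hk).trans ?_
  rw [deriv, SobolevFun.deriv, iteratedDerivWithin_iteratedDerivWithin]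
  exact fun _ _ => rfl

theorem deriv_derivCLM_zero_ae (h : t + q ≤ s) (y : Sobolev a b p s) :
    (derivCLM h y).deriv 0 =ᵐ[volume.restrict (Icc a b)] y.deriv q := by
  simpa using deriv_derivCLM_ae h y (Nat.zero_le t)

theorem norm_derivCLM_le (h : t + q ≤ s) (y : Sobolev a b p s) : ‖derivCLM h y‖ ≤ ‖y‖ := by
  refine ((derivCLM h).le_opNorm y).trans ?_
  refine mul_le_of_le_one_left (norm_nonneg _) ?_
  exact LinearMap.mkContinuous_norm_le _ zero_le_one _

/-- The form of the norm that permits induction on the order in the product estimate and in the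
proof of completeness. -/
theorem norm_succ (y : Sobolev a b p (s + 1)) :
    ‖y‖ = (eLpNorm (y.deriv 0) p (volume.restrict (Icc a b))).toReal +
      ‖derivCLM (q := 1) le_rfl y‖ := by
  rw [norm_eq, Finset.sum_range_succ', add_comm, norm_eq]
  congr 1
  refine Finset.sum_congr rfl fun k hk => ?_
  rw [eLpNorm_congr_ae (deriv_derivCLM_ae _ y (Nat.lt_succ_iff.1 (Finset.mem_range.1 hk)))]

theorem exists_integral_norm_le (a b : ℝ) (p : ℝ≥0∞) [hp : Fact (1 ≤ p)] :
    ∃ C : ℝ, 0 ≤ C ∧ ∀ f : ℝ → ℂ, MemLp f p (volume.restrict (Icc a b)) →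
      ∫ v in Icc a b, ‖f v‖ ≤ C * (eLpNorm f p (volume.restrict (Icc a b))).toReal := by
  -- Hölder's constant, the length of the interval to the power `1 - 1/p`. For `p = ∞` the
  -- conventions `∞.toReal = 0` and `1 / 0 = 0` give the correct exponent `1`.
  refine ⟨_, ENNReal.toReal_nonneg (a := (volume.restrict (Icc a b)) univ ^
    (1 / (1 : ℝ≥0∞).toReal - 1 / p.toReal)), fun f hf => ?_⟩
  have h := eLpNorm_le_eLpNorm_mul_rpow_measure_univ hp.out hf.1
  rw [integral_norm_eq_lintegral_enorm hf.1, ← eLpNorm_one_eq_lintegral_enorm, mul_comm,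
    ← ENNReal.toReal_mul]
  refine ENNReal.toReal_mono (ENNReal.mul_ne_top hf.2.ne ?_) h
  refine ENNReal.rpow_ne_top_of_nonneg ?_ (measure_ne_top _ _)
  rw [ENNReal.toReal_one, div_one, sub_nonneg]
  rcases eq_or_ne p ∞ with rfl | h'
  · simp
  · rw [div_le_one (ENNReal.toReal_pos (zero_lt_one.trans_le hp.out).ne' h')]
    simpa using ENNReal.toReal_mono h' hp.out

theorem exists_eLpNorm_le (a b : ℝ) (p : ℝ≥0∞) :
    ∃ C : ℝ, 0 ≤ C ∧ ∀ (f : ℝ → ℂ) (M : ℝ), 0 ≤ M → (∀ t ∈ Icc a b, ‖f t‖ ≤ M) →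
      (eLpNorm f p (volume.restrict (Icc a b))).toReal ≤ C * M := by
  refine ⟨_, ENNReal.toReal_nonneg (a := (volume.restrict (Icc a b)) univ ^ p.toReal⁻¹),
    fun f M hM h => ?_⟩
  have h1 := eLpNorm_le_of_ae_bound (p := p)
    ((ae_restrict_mem (μ := volume) measurableSet_Icc).mono h)
  have h2 : (volume.restrict (Icc a b)) univ ^ p.toReal⁻¹ ≠ ∞ :=
    ENNReal.rpow_ne_top_of_nonneg (by positivity) (measure_ne_top _ _)
  have h3 := ENNReal.toReal_mono (ENNReal.mul_ne_top h2 ENNReal.ofReal_ne_top) h1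
  rwa [ENNReal.toReal_mul, ENNReal.toReal_ofReal hM] at h3

/-- The embedding of `W_p^s`, `s ≥ 1`, into the bounded functions. -/
theorem exists_norm_le (a b : ℝ) [hab : Fact (a < b)] (p : ℝ≥0∞) [hp : Fact (1 ≤ p)] :
    ∃ C : ℝ, 0 ≤ C ∧ ∀ (s : ℕ) (z : Sobolev a b p (s + 1)), ∀ t ∈ Icc a b,
      ‖z.deriv 0 t‖ ≤ C * ‖z‖ := by
  obtain ⟨C, hC0, hC⟩ := exists_integral_norm_le a b p
  have hpos : 0 < b - a := sub_pos.2 hab.out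
  refine ⟨(b - a)⁻¹ * C + C, by positivity, fun s z t ht => ?_⟩
  have h := (z.deriv_zero_mem.mono hab.out (k := 1) (by omega)).norm_le hp.out hab.out ht
  rw [derivWithin_deriv] at h
  refine h.trans ?_
  rw [add_mul, mul_assoc]
  refine add_le_add (mul_le_mul_of_nonneg_left ?_ (by positivity)) ?_
  · exact (hC _ (z.memLp_deriv (Nat.zero_le _))).trans
      (mul_le_mul_of_nonneg_left (z.eLpNorm_deriv_le (Nat.zero_le _)) hC0)
  · exact (hC _ (z.memLp_deriv (by omega))).trans
      (mul_le_mul_of_nonneg_left (z.eLpNorm_deriv_le (by omega)) hC0)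

/-- Evaluation of a function of class `W_p^(s+1)` at the left end point. -/
noncomputable def evalLeft (a b : ℝ) [hab : Fact (a < b)] (p : ℝ≥0∞) [hp : Fact (1 ≤ p)] (s : ℕ) :
    Sobolev a b p (s + 1) →L[ℂ] ℂ :=
  LinearMap.mkContinuousOfExistsBound
    { toFun := fun z => z.deriv 0 a
      map_add' := fun y z => by rw [deriv_zero_add]; rfl
      map_smul' := fun c y => by rw [deriv_smul]; rfl }
    (by
      obtain ⟨C, -, hC⟩ := exists_norm_le a b p
      exact ⟨C, fun z => hC s z a (left_mem_Icc.2 hab.out.le)⟩)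

theorem evalLeft_apply (z : Sobolev a b p (s + 1)) : evalLeft a b p s z = z.deriv 0 a := rfl

/-- The product of `u ∈ W_p^s` and `z ∈ W_p^(s+1)`. -/
noncomputable def mulFun (u : Sobolev a b p s) (z : Sobolev a b p (s + 1)) : Sobolev a b p s :=
  mkFun (u.deriv 0 * z.deriv 0) (u.deriv_zero_mem.mul hab.out z.deriv_zero_mem)

theorem deriv_mulFun_ae (u : Sobolev a b p s) (z : Sobolev a b p (s + 1)) :
    (mulFun u z).deriv 0 =ᵐ[volume.restrict (Icc a b)] u.deriv 0 * z.deriv 0 :=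
  deriv_mkFun_zero_ae _

/-- The Leibniz rule, arranged so that both terms are again products of orders `s` and `s + 1`.
`derivCLM` with `q := 0` is the embedding that lowers the order by one. -/
theorem derivCLM_mulFun (u : Sobolev a b p (s + 1)) (z : Sobolev a b p (s + 2)) :
    derivCLM (q := 1) le_rfl (mulFun u z) =
      mulFun (derivCLM (q := 1) le_rfl u) (derivCLM (q := 0) (Nat.le_succ _) z) +
      mulFun (derivCLM (q := 0) (Nat.le_succ _) u) (derivCLM (q := 1) le_rfl z) := by
  refine ext_ae ?_
  have hac : ∀ {j : ℕ} (y : Sobolev a b p (j + 1)),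
      AbsolutelyContinuousOnInterval (y.deriv 0) a b := fun y =>
    y.rep.mem.absolutelyContinuous hab.out (Nat.zero_le _)
  have h1 : (mulFun u z).deriv 1 =ᵐ[volume.restrict (Icc a b)]
      iteratedDerivWithin 1 (u.deriv 0 * z.deriv 0) (Icc a b) := deriv_mkFun_ae _ (by omega)
  rw [deriv_zero_add]
  filter_upwards [ae_restrict_mem measurableSet_Icc, h1,
    deriv_derivCLM_zero_ae (q := 1) le_rfl (mulFun u z),
    deriv_mulFun_ae (derivCLM (q := 1) le_rfl u) (derivCLM (q := 0) (Nat.le_succ _) z),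
    deriv_mulFun_ae (derivCLM (q := 0) (Nat.le_succ _) u) (derivCLM (q := 1) le_rfl z),
    deriv_derivCLM_zero_ae (q := 1) le_rfl u, deriv_derivCLM_zero_ae (q := 1) le_rfl z,
    deriv_derivCLM_zero_ae (q := 0) (Nat.le_succ _) u,
    deriv_derivCLM_zero_ae (q := 0) (Nat.le_succ _) z,
    (hac u).ae_differentiableWithinAt_Icc hab.out, (hac z).ae_differentiableWithinAt_Icc hab.out]
    with t ht e1 e2 e3 e4 e5 e6 e7 e8 hu hz
  rw [e2, e1, Pi.add_apply, e3, e4, Pi.mul_apply, Pi.mul_apply, e5, e6, e7, e8,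
    iteratedDerivWithin_one, derivWithin_mul hu hz, derivWithin_deriv, derivWithin_deriv]

/-- The second factor has order at least one and is therefore bounded, even when the first is only
in `L_p`. -/
theorem exists_eLpNorm_mul_le (a b : ℝ) [hab : Fact (a < b)] (p : ℝ≥0∞) [hp : Fact (1 ≤ p)] :
    ∃ C : ℝ, 0 ≤ C ∧ ∀ (s : ℕ) (u : Sobolev a b p s) (z : Sobolev a b p (s + 1)),
      (eLpNorm ((mulFun u z).deriv 0) p (volume.restrict (Icc a b))).toReal ≤ C * ‖u‖ * ‖z‖ := by
  obtain ⟨C, hC0, hC⟩ := exists_norm_le a b p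
  refine ⟨C, hC0, fun s u z => ?_⟩
  rw [eLpNorm_congr_ae (deriv_mulFun_ae u z)]
  have h1 : eLpNorm (u.deriv 0 * z.deriv 0) p (volume.restrict (Icc a b)) ≤
      ENNReal.ofReal (C * ‖z‖) * eLpNorm (u.deriv 0) p (volume.restrict (Icc a b)) := by
    refine eLpNorm_le_mul_eLpNorm_of_ae_le_mul ?_ p
    filter_upwards [ae_restrict_mem measurableSet_Icc] with t ht
    rw [Pi.mul_apply, norm_mul, mul_comm]
    exact mul_le_mul_of_nonneg_right (hC s z t ht) (norm_nonneg _)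
  have h2 := ENNReal.toReal_mono (ENNReal.mul_ne_top ENNReal.ofReal_ne_top
    (u.memLp_deriv (Nat.zero_le _)).2.ne) h1
  rw [ENNReal.toReal_mul, ENNReal.toReal_ofReal (by positivity)] at h2
  refine h2.trans ?_
  rw [mul_right_comm]
  exact mul_le_mul_of_nonneg_right
    (mul_le_mul_of_nonneg_left (u.eLpNorm_deriv_le (Nat.zero_le _)) hC0) (norm_nonneg _)

theorem exists_norm_mulFun_le (a b : ℝ) [hab : Fact (a < b)] (p : ℝ≥0∞) [hp : Fact (1 ≤ p)]
    (s : ℕ) : ∃ C : ℝ, 0 ≤ C ∧ ∀ (u : Sobolev a b p s) (z : Sobolev a b p (s + 1)),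
      ‖mulFun u z‖ ≤ C * ‖u‖ * ‖z‖ := by
  obtain ⟨C, hC0, hC⟩ := exists_eLpNorm_mul_le a b p
  induction s with
  | zero =>
    refine ⟨C, hC0, fun u z => ?_⟩
    exact (le_of_eq (by simp [norm_eq])).trans (hC 0 u z)
  | succ s IH =>
    obtain ⟨D, hD0, hD⟩ := IH
    -- `C` bounds the product itself, and one `D` bounds each Leibniz term.
    refine ⟨C + (D + D), by positivity, fun u z => ?_⟩
    rw [norm_succ, derivCLM_mulFun, add_mul, add_mul, add_mul, add_mul]
    have hm : ∀ (u' : Sobolev a b p s) (z' : Sobolev a b p (s + 1)), ‖u'‖ ≤ ‖u‖ → ‖z'‖ ≤ ‖z‖ →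
        ‖mulFun u' z'‖ ≤ D * ‖u‖ * ‖z‖ := fun u' z' h1 h2 => (hD u' z').trans (by gcongr)
    exact add_le_add (hC _ u z) ((norm_add_le _ _).trans (add_le_add
      (hm _ _ (norm_derivCLM_le _ _) (norm_derivCLM_le _ _))
      (hm _ _ (norm_derivCLM_le _ _) (norm_derivCLM_le _ _))))

/-- Multiplication `W_p^s × W_p^(s+1) → W_p^s` as a bounded bilinear map. -/
noncomputable def mulCLM (a b : ℝ) [hab : Fact (a < b)] (p : ℝ≥0∞) [hp : Fact (1 ≤ p)] (s : ℕ) :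
    Sobolev a b p s →L[ℂ] Sobolev a b p (s + 1) →L[ℂ] Sobolev a b p s :=
  LinearMap.mkContinuous₂
    (LinearMap.mk₂ ℂ mulFun
      (fun u v z => by
        refine ext_ae ?_
        rw [deriv_zero_add]
        filter_upwards [deriv_mulFun_ae (u + v) z, deriv_mulFun_ae u z, deriv_mulFun_ae v z]
          with t h1 h2 h3
        simp only [h1, h2, h3, deriv_zero_add, Pi.add_apply, Pi.mul_apply, add_mul])
      (fun c u z => by
        refine ext_ae ?_
        rw [deriv_smul]
        filter_upwards [deriv_mulFun_ae (c • u) z, deriv_mulFun_ae u z] with t h1 h2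
        simp only [h1, h2, deriv_smul, Pi.smul_apply, Pi.mul_apply, smul_eq_mul, mul_assoc])
      (fun u z w => by
        refine ext_ae ?_
        rw [deriv_zero_add]
        filter_upwards [deriv_mulFun_ae u (z + w), deriv_mulFun_ae u z, deriv_mulFun_ae u w]
          with t h1 h2 h3
        simp only [h1, h2, h3, deriv_zero_add, Pi.add_apply, Pi.mul_apply, mul_add])
      (fun c u z => by
        refine ext_ae ?_
        rw [deriv_smul]
        filter_upwards [deriv_mulFun_ae u (c • z), deriv_mulFun_ae u z] with t h1 h2
        simp only [h1, h2, deriv_smul, Pi.smul_apply, Pi.mul_apply, smul_eq_mul]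
        ring))
    (exists_norm_mulFun_le a b p s).choose (exists_norm_mulFun_le a b p s).choose_spec.2

theorem deriv_mulCLM_ae (u : Sobolev a b p s) (z : Sobolev a b p (s + 1)) :
    (mulCLM a b p s u z).deriv 0 =ᵐ[volume.restrict (Icc a b)] u.deriv 0 * z.deriv 0 :=
  deriv_mulFun_ae u z

/-- Passing to the class of a representative is an isometry onto `L_p`, whose completeness is pulled
back. -/
instance completeSpace_zero : CompleteSpace (Sobolev a b p 0) := by
  let f : Sobolev a b p 0 →+ Lp ℂ p (volume.restrict (Icc a b)) :=
    { toFun := fun y => (y.memLp_deriv le_rfl).toLp (y.deriv 0)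
      map_zero' := by
        rw [Lp.ext_iff]
        refine (MemLp.coeFn_toLp _).trans ((Eq.eventuallyEq ?_).trans (Lp.coeFn_zero _ _ _).symm)
        have := deriv_smul (0 : ℂ) (0 : Sobolev a b p 0) 0
        rwa [zero_smul, zero_smul] at this
      map_add' := fun y z => by
        rw [← MemLp.toLp_add]
        exact MemLp.toLp_congr _ _ (Eq.eventuallyEq (deriv_zero_add y z)) }
  have hf : Isometry f := AddMonoidHomClass.isometry_of_norm f fun y => by
    change ‖(y.memLp_deriv le_rfl).toLp (y.deriv 0)‖ = _
    rw [Lp.norm_toLp, norm_eq, zero_add, Finset.sum_range_one]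
  refine (hf.isUniformInducing.completeSpace_congr fun g => ?_).2 inferInstance
  have hg : SobolevMem a b p 0 g := Lp.memLp g
  refine ⟨mkFun g hg, ?_⟩
  rw [Lp.ext_iff]
  exact (MemLp.coeFn_toLp (memLp_deriv (mkFun g hg) le_rfl)).trans (deriv_mkFun_zero_ae hg)

/-- A function is recovered from `y(a)` and `y'` by integration, so `y ↦ (y(a), y')` is bounded
below. -/
theorem exists_norm_le_evalLeft_derivCLM (a b : ℝ) [hab : Fact (a < b)] (p : ℝ≥0∞)
    [hp : Fact (1 ≤ p)] : ∃ C : ℝ, 0 ≤ C ∧ ∀ (s : ℕ) (y : Sobolev a b p (s + 1)),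
      ‖y‖ ≤ C * (‖evalLeft a b p s y‖ + ‖derivCLM (q := 1) le_rfl y‖) := by
  obtain ⟨C, hC0, hC⟩ := exists_integral_norm_le a b p
  obtain ⟨V, hV0, hV⟩ := exists_eLpNorm_le a b p
  -- `C` bounds `∫ ‖y'‖`, `V` turns the resulting sup bound on `y` into an `L_p` bound, and the
  -- final `1` accounts for the norm of `y'`.
  refine ⟨V * (1 + C) + 1, by positivity, fun s y => ?_⟩
  have hI : IntervalIntegrable (y.deriv 1) volume a b :=
    MemLp.intervalIntegrable_Icc hp.out hab.out (y.memLp_deriv (by omega))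
  have h1 : ∀ t ∈ Icc a b, ‖y.deriv 0 t‖ ≤
      ‖evalLeft a b p s y‖ + C * ‖derivCLM (q := 1) le_rfl y‖ := fun t ht => by
    rw [y.deriv_zero_mem.eq_add_integral hp.out hab.out ht, derivWithin_deriv, evalLeft_apply]
    refine (norm_add_le _ _).trans (add_le_add le_rfl ?_)
    refine (intervalIntegral.norm_integral_le_integral_norm ht.1).trans ?_
    rw [intervalIntegral.integral_of_le ht.1]
    refine le_trans (setIntegral_mono_set
      ((intervalIntegrable_iff_integrableOn_Icc_of_le hab.out.le).1 hI).norm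
      (ae_of_all _ fun _ => norm_nonneg _)
      (LE.le.eventuallyLE (Ioc_subset_Icc_self.trans (Icc_subset_Icc_right ht.2)))) ?_
    refine (hC _ (y.memLp_deriv (by omega))).trans (mul_le_mul_of_nonneg_left ?_ hC0)
    rw [← eLpNorm_congr_ae (deriv_derivCLM_zero_ae (q := 1) le_rfl y)]
    exact eLpNorm_deriv_le _ (Nat.zero_le _)
  have h2 := hV _ _ (by positivity) h1
  rw [norm_succ]
  have h3 : 0 ≤ ‖evalLeft a b p s y‖ := norm_nonneg _
  have h4 : 0 ≤ ‖derivCLM (q := 1) (le_refl (s + 1)) y‖ := norm_nonneg _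
  nlinarith [mul_nonneg hV0 hC0, mul_nonneg (mul_nonneg hV0 hC0) h3, mul_nonneg hV0 h4]

/-- The primitive of `g ∈ W_p^s` with the value `c` at the left end point. -/
theorem exists_evalLeft_derivCLM_eq (c : ℂ) (g : Sobolev a b p s) :
    ∃ y : Sobolev a b p (s + 1), evalLeft a b p s y = c ∧ derivCLM (q := 1) le_rfl y = g := by
  have hy : SobolevMem a b p (s + 1) (fun t => c + ∫ v in a..t, g.deriv 0 v) :=
    SobolevMem.of_eq_add_integral hp.out hab.out g.deriv_zero_mem fun _ _ => rfl
  refine ⟨mkFun _ hy, ?_, ext_ae ?_⟩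
  · rw [evalLeft_apply, deriv_mkFun_eqOn hy (Nat.succ_pos s) (left_mem_Icc.2 hab.out.le)]
    simp
  · refine (deriv_derivCLM_zero_ae _ _).trans ((deriv_mkFun_ae hy (by omega)).trans ?_)
    rw [iteratedDerivWithin_one]
    exact derivWithin_ae_eq_of_eq_add_integral hab.out
      (g.deriv_zero_mem.intervalIntegrable hp.out hab.out) fun _ _ => rfl

/-- The map `y ↦ (y(a), y')` onto `ℂ × W_p^s` is bounded, bounded below and surjective, so
completeness climbs one order. -/
theorem completeSpace_succ [CompleteSpace (Sobolev a b p s)] :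
    CompleteSpace (Sobolev a b p (s + 1)) := by
  let F := (evalLeft a b p s).prod (derivCLM (a := a) (b := b) (p := p) (q := 1) (le_refl (s + 1)))
  obtain ⟨C, hC0, hC⟩ := exists_norm_le_evalLeft_derivCLM a b p
  -- The product carries the maximum norm, and a sum of two components is at most twice their
  -- maximum.
  have hF : AntilipschitzWith (C * 2).toNNReal F := by
    refine F.antilipschitz_of_bound fun y => ?_
    rw [Real.coe_toNNReal _ (by positivity), mul_assoc]
    refine (hC s y).trans (mul_le_mul_of_nonneg_left ?_ hC0)
    have h1 : ‖evalLeft a b p s y‖ ≤ ‖F y‖ := norm_fst_le (F y)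
    have h2 : ‖derivCLM (q := 1) (le_refl (s + 1)) y‖ ≤ ‖F y‖ := norm_snd_le (F y)
    linarith
  refine ((hF.isUniformInducing F.uniformContinuous).completeSpace_congr fun g => ?_).2
    inferInstance
  obtain ⟨y, h1, h2⟩ := exists_evalLeft_derivCLM_eq g.1 g.2
  exact ⟨y, Prod.ext h1 h2⟩

instance completeSpace : CompleteSpace (Sobolev a b p s) := by
  induction s with
  | zero => exact completeSpace_zero
  | succ s IH => exact completeSpace_succ

end Sobolev

/-- The product of `u ∈ W_p^s` and a continuous `z ∈ W_p^s` is in `W_p^s`. -/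
theorem SobolevMem.mul_of_continuousOn {a b : ℝ} {p : ℝ≥0∞} {s : ℕ} {y z : ℝ → ℂ}
    (hp : 1 ≤ p) (hab : a < b) (hy : SobolevMem a b p s y) (hz : SobolevMem a b p s z)
    (hzc : ContinuousOn z (Icc a b)) : SobolevMem a b p s (y * z) := by
  cases s with
  | zero => exact MemLp.mul (p := p) (q := ∞) (r := p) (memLp_of_continuousOn_Icc hzc ∞) hy
  | succ s => exact hy.mul_self hp hab hz

/-! ### The first-order companion system -/

section Companion

variable {m r : ℕ} {a b : ℝ}

/-- The right-hand side of the first-order system for `(y, y', …, y^(r-1))` that is equivalent to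
`y^(r) + ∑ A_q y^(q) = f`. -/
noncomputable def companionField (A : Fin r → Fin m → Fin m → ℝ → ℂ) (f : Fin m → ℝ → ℂ) (t : ℝ)
    (x : Fin r → Fin m → ℂ) : Fin r → Fin m → ℂ := fun q i =>
  if h : q.1 + 1 < r then x ⟨q + 1, h⟩ i else f i t - ∑ q', ∑ j, A q' i j t * x q' j

/-- A Lipschitz constant of `companionField A f t`. -/
noncomputable def companionBound (A : Fin r → Fin m → Fin m → ℝ → ℂ) (t : ℝ) : ℝ :=
  1 + ∑ i, ∑ q, ∑ j, ‖A q i j t‖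

theorem companionBound_nonneg (A : Fin r → Fin m → Fin m → ℝ → ℂ) (t : ℝ) :
    0 ≤ companionBound A t := by
  unfold companionBound; positivity

theorem intervalIntegrable_finsetSum {ι : Type*} [Fintype ι] {E : Type*} [NormedAddCommGroup E]
    {f : ι → ℝ → E} (h : ∀ i, IntervalIntegrable (f i) volume a b) :
    IntervalIntegrable (fun t => ∑ i, f i t) volume a b := by
  simp only [intervalIntegrable_iff] at h ⊢
  exact integrable_finsetSum _ fun i _ => h i

theorem intervalIntegrable_companionBound {A : Fin r → Fin m → Fin m → ℝ → ℂ}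
    (hA : ∀ q i j, IntervalIntegrable (A q i j) volume a b) :
    IntervalIntegrable (companionBound A) volume a b := by
  have h : IntervalIntegrable (fun t => ∑ i, ∑ q, ∑ j, ‖A q i j t‖) volume a b :=
    intervalIntegrable_finsetSum fun i => intervalIntegrable_finsetSum fun q =>
      intervalIntegrable_finsetSum fun j => (hA q i j).norm
  exact intervalIntegrable_const.add h

/-- The shift components have Lipschitz constant `1`; in the last one `f` cancels and the entries of
the coefficients remain. -/
theorem norm_companionField_sub_le (A : Fin r → Fin m → Fin m → ℝ → ℂ) (f : Fin m → ℝ → ℂ) (t : ℝ)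
    (x y : Fin r → Fin m → ℂ) :
    ‖companionField A f t x - companionField A f t y‖ ≤ companionBound A t * ‖x - y‖ := by
  have hb : 0 ≤ companionBound A t * ‖x - y‖ :=
    mul_nonneg (companionBound_nonneg A t) (norm_nonneg _)
  have hxy : ∀ q i, ‖x q i - y q i‖ ≤ ‖x - y‖ := fun q i =>
    (norm_le_pi_norm ((x - y) q) i).trans (norm_le_pi_norm (x - y) q)
  refine (pi_norm_le_iff_of_nonneg hb).2 fun q => (pi_norm_le_iff_of_nonneg hb).2 fun i => ?_
  rw [Pi.sub_apply, Pi.sub_apply]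
  have h0 : 0 ≤ ∑ i, ∑ q, ∑ j, ‖A q i j t‖ := by positivity
  unfold companionField
  split_ifs with h
  · refine (hxy _ _).trans (le_mul_of_one_le_left (norm_nonneg _) ?_)
    unfold companionBound
    linarith
  · rw [sub_sub_sub_cancel_left, ← Finset.sum_sub_distrib]
    have h1 : ‖∑ q', (∑ j, A q' i j t * y q' j - ∑ j, A q' i j t * x q' j)‖ ≤
        (∑ q', ∑ j, ‖A q' i j t‖) * ‖x - y‖ := by
      rw [Finset.sum_mul]
      refine norm_sum_le_of_le _ fun q' _ => ?_
      rw [← Finset.sum_sub_distrib, Finset.sum_mul]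
      refine norm_sum_le_of_le _ fun j _ => ?_
      rw [← mul_sub, norm_mul, norm_sub_rev]
      exact mul_le_mul_of_nonneg_left (hxy _ _) (norm_nonneg _)
    refine h1.trans (mul_le_mul_of_nonneg_right ?_ (norm_nonneg _))
    have h2 := Finset.single_le_sum (f := fun i => ∑ q, ∑ j, ‖A q i j t‖)
      (fun i _ => by positivity) (Finset.mem_univ i)
    unfold companionBound
    linarith

theorem intervalIntegrable_pi {ι : Type*} [Fintype ι] {E : Type*} [NormedAddCommGroup E]
    {f : ℝ → ι → E} (h : ∀ i, IntervalIntegrable (fun t => f t i) volume a b) :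
    IntervalIntegrable f volume a b := by
  simp only [intervalIntegrable_iff] at h ⊢
  exact Integrable.of_eval h

theorem intervalIntegrable_companionField {A : Fin r → Fin m → Fin m → ℝ → ℂ}
    {f : Fin m → ℝ → ℂ} (hab : a ≤ b) (hA : ∀ q i j, IntervalIntegrable (A q i j) volume a b)
    (hf : ∀ i, IntervalIntegrable (f i) volume a b) {v : ℝ → Fin r → Fin m → ℂ}
    (hv : ContinuousOn v (Icc a b)) :
    IntervalIntegrable (fun t => companionField A f t (v t)) volume a b := by
  rw [← uIcc_of_le hab] at hv
  have hvc : ∀ q i, ContinuousOn (fun t => v t q i) (uIcc a b) := fun q i =>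
    continuousOn_pi.1 (continuousOn_pi.1 hv q) i
  refine intervalIntegrable_pi fun q => intervalIntegrable_pi fun i => ?_
  unfold companionField
  split_ifs with h
  · exact (hvc _ _).intervalIntegrable
  · refine (hf i).sub ?_
    exact intervalIntegrable_finsetSum fun q' => intervalIntegrable_finsetSum fun j =>
      (hA q' i j).mul_continuousOn (hvc q' j)

theorem intervalIntegral_apply_apply {v : ℝ → Fin r → Fin m → ℂ}
    (hv : IntervalIntegrable v volume a b) (q : Fin r) (i : Fin m) :
    (∫ t in a..b, v t) q i = ∫ t in a..b, v t q i :=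
  (((ContinuousLinearMap.proj (R := ℝ) (φ := fun _ : Fin m => ℂ) i).comp
    (ContinuousLinearMap.proj (R := ℝ) (φ := fun _ : Fin r => Fin m → ℂ) q)
    ).intervalIntegral_comp_comm hv).symm

theorem exists_companion_solution {A : Fin r → Fin m → Fin m → ℝ → ℂ} {f : Fin m → ℝ → ℂ}
    (hab : a ≤ b) (hA : ∀ q i j, IntervalIntegrable (A q i j) volume a b)
    (hf : ∀ i, IntervalIntegrable (f i) volume a b) (c : Fin r → Fin m → ℂ) :
    ∃ v : ℝ → Fin r → Fin m → ℂ, ContinuousOn v (Icc a b) ∧ ∀ q i, ∀ t ∈ Icc a b,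
      v t q i = c q i + ∫ s in a..t, companionField A f s (v s) q i := by
  obtain ⟨v, hv, h⟩ := exists_eq_add_integral hab (intervalIntegrable_companionBound hA)
    (fun t _ => companionBound_nonneg A t) (fun t _ => norm_companionField_sub_le A f t)
    (fun v hv => intervalIntegrable_companionField hab hA hf hv) c
  refine ⟨v, hv, fun q i t ht => ?_⟩
  have hI := (intervalIntegrable_companionField hab hA hf hv).mono_set
    (uIcc_subset_uIcc_left (by rwa [uIcc_of_le hab] : t ∈ uIcc a b))
  rw [← intervalIntegral_apply_apply hI]
  exact congrFun (congrFun (h t ht) q) i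

theorem companion_solution_eq_zero {A : Fin r → Fin m → Fin m → ℝ → ℂ}
    (hab : a ≤ b) (hA : ∀ q i j, IntervalIntegrable (A q i j) volume a b)
    {v : ℝ → Fin r → Fin m → ℂ} (hv : ContinuousOn v (Icc a b))
    (h : ∀ q i, ∀ t ∈ Icc a b,
      v t q i = ∫ s in a..t, companionField A (fun _ _ => 0) s (v s) q i) :
    ∀ t ∈ Icc a b, v t = 0 := by
  have hI := intervalIntegrable_companionField (f := fun _ _ => 0) hab hA
    (fun _ => intervalIntegrable_const) hv
  have hκ := intervalIntegrable_companionBound hA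
  refine eq_zero_of_norm_le_integral hab hκ
    (fun t _ => companionBound_nonneg A t) hv fun t ht => ?_
  have hsub : uIcc a t ⊆ uIcc a b := uIcc_subset_uIcc_left (by rwa [uIcc_of_le hab])
  have h1 : v t = ∫ s in a..t, companionField A (fun _ _ => 0) s (v s) := by
    ext q i
    rw [intervalIntegral_apply_apply (hI.mono_set hsub), h q i t ht]
  rw [h1]
  refine intervalIntegral.norm_integral_le_of_norm_le ht.1 (ae_of_all _ fun s _ => ?_)
    ((hκ.mul_continuousOn (by rw [uIcc_of_le hab]; exact hv.norm)).mono_set hsub)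
  have h2 := norm_companionField_sub_le A (fun _ _ => 0) s (v s) 0
  have h3 : companionField A (fun _ _ => 0) s 0 = 0 := by
    ext q i
    simp [companionField]
  rwa [h3, sub_zero, sub_zero] at h2

end Companion

/-! ### Regularity of solutions of the companion system -/

section Regularity

variable {a b : ℝ} {p : ℝ≥0∞} {m n r : ℕ}

/-- A bootstrap. The integral equation raises the order of all components together by one at a time,
until coefficients of order `n` stop it at `n + 1`. Below the last index each component is a
primitive of the next, which gains one order per step; `d` counts these steps, so component `0`
reaches `n + 1 + (r - 1) = n + r`. -/
theorem companion_solution_mem (hp : 1 ≤ p) (hab : a < b) {A : Fin r → Fin m → Fin m → ℝ → ℂ}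
    {f : Fin m → ℝ → ℂ} (hA : ∀ q i j, SobolevMem a b p n (A q i j))
    (hf : ∀ i, SobolevMem a b p n (f i)) {c : Fin r → Fin m → ℂ} {v : ℝ → Fin r → Fin m → ℂ}
    (hv : ContinuousOn v (Icc a b)) (h : ∀ q i, ∀ t ∈ Icc a b,
      v t q i = c q i + ∫ s in a..t, companionField A f s (v s) q i) :
    ∀ (d : ℕ) (q : Fin r), q.1 + d + 1 = r → ∀ i, SobolevMem a b p (n + 1 + d)
      (fun t => v t q i) := by
  have hvc : ∀ q i, ContinuousOn (fun t => v t q i) (Icc a b) := fun q i =>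
    continuousOn_pi.1 (continuousOn_pi.1 hv q) i
  have h1 : ∀ s ≤ n + 1, ∀ q i, SobolevMem a b p s (fun t => v t q i) := by
    intro s
    induction s with
    | zero => exact fun _ q i => memLp_of_continuousOn_Icc (hvc q i) p
    | succ s IH =>
      intro hs q i
      refine SobolevMem.of_eq_add_integral hp hab ?_ (h q i)
      unfold companionField
      split_ifs with hq
      · exact IH (by omega) _ _
      · have hsum : SobolevMem a b p s
            (∑ q', ∑ j, (A q' i j * fun t => v t q' j)) :=
          -- Continuity of `v` matters at order zero, where a product of two `L_p` functions need
          -- not be in `L_p`.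
          SobolevMem.finsetSum hab _ fun q' _ => SobolevMem.finsetSum hab _ fun j _ =>
            ((hA q' i j).mono hab (by omega)).mul_of_continuousOn hp hab
              (IH (by omega) q' j) (hvc q' j)
        refine (((hf i).mono hab (k := s) (by omega)).add hab (hsum.smul (-1))).congr hab ?_
        intro t _
        simp [sub_eq_add_neg]
  intro d
  induction d with
  | zero => exact fun q _ i => h1 _ le_rfl q i
  | succ d IH =>
    intro q hq i
    refine SobolevMem.of_eq_add_integral hp hab ?_ (h q i)
    have hq' : q.1 + 1 < r := by omega
    unfold companionField
    simp only [hq', dif_pos]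
    exact IH ⟨q + 1, hq'⟩ (by simp only; omega) i

theorem iteratedDerivWithin_companion_solution (hab : a < b)
    {A : Fin r → Fin m → Fin m → ℝ → ℂ}
    {f : Fin m → ℝ → ℂ} {c : Fin r → Fin m → ℂ} {v : ℝ → Fin r → Fin m → ℂ}
    (hv : ContinuousOn v (Icc a b)) (h : ∀ q i, ∀ t ∈ Icc a b,
      v t q i = c q i + ∫ s in a..t, companionField A f s (v s) q i) (hr : 0 < r) (i : Fin m)
    (q : ℕ) (hq : q < r) :
    EqOn (iteratedDerivWithin q (fun t => v t ⟨0, hr⟩ i) (Icc a b)) (fun t => v t ⟨q, hq⟩ i)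
      (Icc a b) := by
  have hvc : ∀ q i, ContinuousOn (fun t => v t q i) (Icc a b) := fun q i =>
    continuousOn_pi.1 (continuousOn_pi.1 hv q) i
  induction q with
  | zero => simp [EqOn]
  | succ q IH =>
    intro t ht
    rw [iteratedDerivWithin_succ, derivWithin_congr (IH (by omega)) (IH (by omega) ht)]
    have hd := hasDerivWithinAt_of_eq_add_integral (z := fun t => v t ⟨q, by omega⟩ i)
      (g := fun t => v t ⟨q + 1, hq⟩ i) (c := c ⟨q, by omega⟩ i) hab (hvc _ _) (fun t ht => by
        have := h ⟨q, by omega⟩ i t ht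
        simpa only [companionField, hq, dif_pos] using this) ht
    exact hd.derivWithin (uniqueDiffOn_Icc hab t ht)

end Regularity

/-! ### The operator `(L, C)`, its inverse and its dependence on the coefficients -/

section BoundaryValueOperators

variable {a b : ℝ} [hab : Fact (a < b)] {p : ℝ≥0∞} [hp : Fact (1 ≤ p)] {m n r l : ℕ}

theorem Sobolev.deriv_zero_sum {s : ℕ} {ι : Type*} (S : Finset ι) (f : ι → Sobolev a b p s) :
    (∑ i ∈ S, f i).deriv 0 = ∑ i ∈ S, (f i).deriv 0 :=
  map_sum (AddMonoidHom.mk' (fun y : Sobolev a b p s => y.deriv 0) Sobolev.deriv_zero_add) f S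

/-- The derivative of order `q` of the `i`-th component, as a bounded operator. -/
noncomputable def coordDeriv {s t q : ℕ} (h : t + q ≤ s) (i : Fin m) :
    (Fin m → Sobolev a b p s) →L[ℂ] Sobolev a b p t :=
  (Sobolev.derivCLM h).comp
    (ContinuousLinearMap.proj (R := ℂ) (φ := fun _ : Fin m => Sobolev a b p s) i)

theorem coordDeriv_apply {s t q : ℕ} (h : t + q ≤ s) (i : Fin m) (y : Fin m → Sobolev a b p s) :
    coordDeriv h i y = Sobolev.derivCLM h (y i) := rfl

/-- The `i`-th component of the operator `L`, as a bounded operator. -/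
noncomputable def diffComponent (A : Fin r → Matrix (Fin m) (Fin m) (Sobolev a b p n))
    (i : Fin m) : (Fin m → Sobolev a b p (n + r)) →L[ℂ] Sobolev a b p n :=
  coordDeriv (q := r) le_rfl i +
    ∑ q : Fin r, ∑ j : Fin m, (Sobolev.mulCLM a b p n (A q i j)).comp
      (coordDeriv (t := n + 1) (q := q) (by omega) j)

theorem diffComponent_apply (A : Fin r → Matrix (Fin m) (Fin m) (Sobolev a b p n))
    (i : Fin m) (y : Fin m → Sobolev a b p (n + r)) :
    diffComponent A i y = Sobolev.derivCLM (q := r) le_rfl (y i) + ∑ q : Fin r, ∑ j : Fin m,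
      Sobolev.mulCLM a b p n (A q i j)
        (Sobolev.derivCLM (t := n + 1) (q := q) (by omega) (y j)) := by
  simp [diffComponent, coordDeriv_apply]

theorem diffComponent_deriv_ae (A : Fin r → Matrix (Fin m) (Fin m) (Sobolev a b p n))
    (i : Fin m) (y : Fin m → Sobolev a b p (n + r)) :
    (diffComponent A i y).deriv 0 =ᵐ[volume.restrict (Icc a b)] diffExpr A y i := by
  have h1 : ∀ᵐ t ∂(volume.restrict (Icc a b)), ∀ (q : Fin r) (j : Fin m),
      (Sobolev.mulCLM a b p n (A q i j)
        (Sobolev.derivCLM (t := n + 1) (q := q) (by omega) (y j))).deriv 0 t =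
      (A q i j).deriv 0 t * (y j).deriv q t :=
    ae_all_iff.2 fun q => ae_all_iff.2 fun j => by
      filter_upwards [Sobolev.deriv_mulCLM_ae (A q i j)
        (Sobolev.derivCLM (t := n + 1) (q := q) (by omega) (y j)),
        Sobolev.deriv_derivCLM_zero_ae (t := n + 1) (q := q) (by omega) (y j)] with t h2 h3
      rw [h2, Pi.mul_apply, h3]
  rw [diffComponent_apply, Sobolev.deriv_zero_add, Sobolev.deriv_zero_sum]
  filter_upwards [h1, Sobolev.deriv_derivCLM_zero_ae (q := r) le_rfl (y i)] with t h2 h3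
  simp only [diffExpr, Pi.add_apply, Finset.sum_apply, Pi.mul_apply, h3, Sobolev.deriv_zero_sum, h2]

/-- Rewrites `L` through bounded differentiations and products, which exhibits its continuity in `y`
and in the coefficients. -/
theorem diffOp_apply (A : Fin r → Matrix (Fin m) (Fin m) (Sobolev a b p n))
    (y : Fin m → Sobolev a b p (n + r)) (i : Fin m) : diffOp A y i = diffComponent A i y :=
  (Sobolev.mkFun_eq_iff (diffExpr_mem A y i)).2 (diffComponent_deriv_ae A i y).symm

/-- The operator `(L, C)`, where `C y = (y(a), y'(a), …, y^(r-1)(a))`. -/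
noncomputable def cauchyOp (A : Fin r → Matrix (Fin m) (Fin m) (Sobolev a b p n)) :
    (Fin m → Sobolev a b p (n + r)) →L[ℂ] (Fin m → Sobolev a b p n) × (Fin r → Fin m → ℂ) :=
  (ContinuousLinearMap.inl ℂ (Fin m → Sobolev a b p n) (Fin r → Fin m → ℂ)).comp
    (∑ i, (ContinuousLinearMap.single ℂ (fun _ : Fin m => Sobolev a b p n) i).comp
      (diffComponent A i)) +
  (ContinuousLinearMap.inr ℂ (Fin m → Sobolev a b p n) (Fin r → Fin m → ℂ)).comp (ContinuousLinearMap.pi fun q : Fin r =>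
    ContinuousLinearMap.pi fun i => (Sobolev.evalLeft a b p n).comp
      (coordDeriv (t := n + 1) (q := q) (by omega) i))

theorem cauchyOp_apply (A : Fin r → Matrix (Fin m) (Fin m) (Sobolev a b p n))
    (y : Fin m → Sobolev a b p (n + r)) :
    cauchyOp A y = (diffOp A y, fun (q : Fin r) i => (y i).deriv q a) := by
  refine Prod.ext (funext fun i => ?_) (funext fun q => funext fun i => ?_)
  · refine Eq.trans ?_ (diffOp_apply A y i).symm
    simp [cauchyOp, Prod.fst_sum]
  · have h := Sobolev.deriv_derivCLM_eqOn (t := n + 1) (q := q) (by omega) (y i) (k := 0)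
      (Nat.succ_pos n) (left_mem_Icc.2 hab.out.le)
    rw [zero_add] at h
    simpa [cauchyOp, Prod.snd_sum, coordDeriv_apply, Sobolev.evalLeft_apply] using h

theorem isCauchySolution_iff {A : Fin r → Matrix (Fin m) (Fin m) (Sobolev a b p n)} {k : Fin r}
    {Y : Matrix (Fin m) (Fin m) (Sobolev a b p (n + r))} :
    IsCauchySolution A k Y ↔ ∀ c, cauchyOp A (fun i => Y i c) =
      (0, fun j i => if j = k then (1 : Matrix (Fin m) (Fin m) ℂ) i c else 0) := by
  simp only [IsCauchySolution, cauchyOp_apply, Prod.mk.injEq, forall_and, funext_iff]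
  exact and_congr_right fun _ => ⟨fun h c j i => h j i c, fun h j i c => h c j i⟩

/-- For `y` in the kernel, `(y, y', …, y^(r-1))` solves the homogeneous companion system with zero
initial data, and Grönwall applies. -/
theorem cauchyOp_injective (hr : 1 ≤ r)
    (A : Fin r → Matrix (Fin m) (Fin m) (Sobolev a b p n)) : Function.Injective (cauchyOp A) := by
  rw [injective_iff_map_eq_zero]
  intro y hy
  rw [cauchyOp_apply, Prod.mk_eq_zero] at hy
  have hL : ∀ i, diffExpr A y i =ᵐ[volume.restrict (Icc a b)] 0 := fun i => by
    have h1 := (Sobolev.mkFun_eq_iff (diffExpr_mem A y i)).1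
      (show Sobolev.mkFun _ (diffExpr_mem A y i) = 0 from congrFun hy.1 i)
    refine h1.trans (Eq.eventuallyEq ?_)
    -- Representatives are chosen linearly, so zero is represented by the zero function; this is
    -- read off from `0 • 0`.
    have := Sobolev.deriv_smul (0 : ℂ) (0 : Sobolev a b p n) 0
    rwa [zero_smul, zero_smul] at this
  have hmem : ∀ (q : Fin r) i, SobolevMem a b p (0 + 1) ((y i).deriv q) := fun q i =>
    (y i).deriv_mem (by omega)
  have hzero := companion_solution_eq_zero (A := fun q i j => (A q i j).deriv 0)
    (v := fun t q i => (y i).deriv q t) hab.out.le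
    (fun q i j => (A q i j).deriv_zero_mem.intervalIntegrable hp.out hab.out)
    (continuousOn_pi.2 fun q => continuousOn_pi.2 fun i => (hmem q i).continuousOn)
    (fun q i t ht => by
      have h0 : (y i).deriv q a = 0 := congrFun (congrFun hy.2 q) i
      rw [(hmem q i).eq_add_integral hp.out hab.out ht, h0, zero_add, Sobolev.derivWithin_deriv]
      refine intervalIntegral.integral_congr_ae_restrict ?_
      rw [uIoc_of_le ht.1]
      refine ae_restrict_of_ae_restrict_of_subset
        (Ioc_subset_Icc_self.trans (Icc_subset_Icc_right ht.2)) ?_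
      filter_upwards [hL i] with s hs
      unfold companionField
      split_ifs with hq
      · rfl
      · have hq' : q.1 + 1 = r := by omega
        simp only [diffExpr, Pi.add_apply, Finset.sum_apply, Pi.mul_apply, Pi.zero_apply] at hs
        rw [hq', zero_sub]
        exact eq_neg_of_add_eq_zero_left hs)
  funext i
  refine Sobolev.ext_ae ?_
  have h0 := Sobolev.deriv_smul (0 : ℂ) (0 : Sobolev a b p (n + r)) 0
  rw [zero_smul, zero_smul] at h0
  rw [Pi.zero_apply, h0]
  filter_upwards [ae_restrict_mem measurableSet_Icc] with t ht
  exact congrFun (congrFun (hzero t ht) ⟨0, hr⟩) i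

/-- Component `0` of a companion solution with the prescribed data is the preimage; its derivatives
of order below `r` are the other components. -/
theorem cauchyOp_surjective (hr : 1 ≤ r)
    (A : Fin r → Matrix (Fin m) (Fin m) (Sobolev a b p n)) : Function.Surjective (cauchyOp A) := by
  rintro ⟨f, c⟩
  have hA : ∀ q i j, SobolevMem a b p n ((A q i j).deriv 0) := fun q i j =>
    (A q i j).deriv_zero_mem
  have hf : ∀ i, SobolevMem a b p n ((f i).deriv 0) := fun i => (f i).deriv_zero_mem
  obtain ⟨v, hv, h⟩ := exists_companion_solution (A := fun q i j => (A q i j).deriv 0)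
    (f := fun i => (f i).deriv 0) hab.out.le
    (fun q i j => (hA q i j).intervalIntegrable hp.out hab.out)
    (fun i => (hf i).intervalIntegrable hp.out hab.out) c
  have hmem : ∀ i, SobolevMem a b p (n + r) (fun t => v t ⟨0, hr⟩ i) := fun i => by
    have := companion_solution_mem hp.out hab.out hA hf hv h (r - 1) ⟨0, hr⟩
      (by simp only; omega) i
    rwa [show n + 1 + (r - 1) = n + r by omega] at this
  have hder := iteratedDerivWithin_companion_solution hab.out hv h hr
  have hval : ∀ (q : Fin r) (i : Fin m), EqOn ((Sobolev.mkFun _ (hmem i)).deriv q)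
      (fun t => v t q i) (Icc a b) := fun q i =>
    (Sobolev.deriv_mkFun_eqOn (hmem i) (by omega)).trans (hder i q q.2)
  refine ⟨fun i => Sobolev.mkFun _ (hmem i), ?_⟩
  rw [cauchyOp_apply]
  refine Prod.ext (funext fun i => ?_) (funext fun q => funext fun i => ?_)
  · refine (Sobolev.mkFun_eq_iff (diffExpr_mem A _ i)).2 ?_
    obtain ⟨r, rfl⟩ : ∃ r', r = r' + 1 := ⟨r - 1, by omega⟩
    -- The last component has this derivative only almost everywhere, since the coefficients and `f`
    -- may be merely in `L_p`.
    have hlast : derivWithin (fun t => v t (Fin.last r) i) (Icc a b)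
        =ᵐ[volume.restrict (Icc a b)]
        fun s => companionField (fun q i j => (A q i j).deriv 0) (fun i => (f i).deriv 0) s (v s)
          (Fin.last r) i := by
      refine derivWithin_ae_eq_of_eq_add_integral hab.out ?_ (h (Fin.last r) i)
      have hI := intervalIntegrable_companionField (A := fun q i j => (A q i j).deriv 0)
        (f := fun i => (f i).deriv 0) hab.out.le
        (fun q i j => (hA q i j).intervalIntegrable hp.out hab.out)
        (fun i => (hf i).intervalIntegrable hp.out hab.out) hv
      rw [intervalIntegrable_iff] at hI ⊢
      exact (hI.eval (Fin.last r)).eval i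
    filter_upwards [ae_restrict_mem measurableSet_Icc, hlast,
      Sobolev.deriv_mkFun_ae (hmem i) (k := r + 1) (by omega)] with t ht h1 h2
    have h3 : (Sobolev.mkFun _ (hmem i)).deriv (r + 1) t =
        (f i).deriv 0 t - ∑ q, ∑ j, (A q i j).deriv 0 t * v t q j := by
      rw [h2, iteratedDerivWithin_succ, derivWithin_congr (hder i r (by omega))
        (hder i r (by omega) ht)]
      refine h1.trans ?_
      simp [companionField]
    simp only [diffExpr, Pi.add_apply, Finset.sum_apply, Pi.mul_apply, h3]
    rw [sub_add, sub_eq_self, sub_eq_zero]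
    exact Finset.sum_congr rfl fun q _ => Finset.sum_congr rfl fun j _ => by rw [hval q j ht]
  · change (Sobolev.mkFun _ (hmem i)).deriv q a = c q i
    rw [hval q i (left_mem_Icc.2 hab.out.le)]
    have := h q i a (left_mem_Icc.2 hab.out.le)
    simpa using this

/-- The open mapping theorem, which is why completeness of `W_p^s` is needed. -/
theorem cauchyOp_isInvertible (hr : 1 ≤ r)
    (A : Fin r → Matrix (Fin m) (Fin m) (Sobolev a b p n)) : (cauchyOp A).IsInvertible :=
  ⟨ContinuousLinearEquiv.ofBijective (cauchyOp A)
    (LinearMap.ker_eq_bot.2 (cauchyOp_injective hr A))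
    (LinearMap.range_eq_top.2 (cauchyOp_surjective hr A)),
    ContinuousLinearEquiv.coe_ofBijective _ _ _⟩

/-- The data on the right do not involve `A`: the solution depends on the coefficients through the
inverse alone. -/
theorem isCauchySolution_iff_eq_inverse (hr : 1 ≤ r)
    {A : Fin r → Matrix (Fin m) (Fin m) (Sobolev a b p n)} {k : Fin r}
    {Y : Matrix (Fin m) (Fin m) (Sobolev a b p (n + r))} :
    IsCauchySolution A k Y ↔ ∀ c, (fun i => Y i c) = (cauchyOp A).inverse
      (0, fun j i => if j = k then (1 : Matrix (Fin m) (Fin m) ℂ) i c else 0) := by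
  rw [isCauchySolution_iff]
  refine forall_congr' fun c => ?_
  rw [eq_comm, ← (cauchyOp_isInvertible hr A).inverse_apply_eq, eq_comm]

theorem existsUnique_isCauchySolution (hr : 1 ≤ r)
    (A : Fin r → Matrix (Fin m) (Fin m) (Sobolev a b p n)) (k : Fin r) :
    ∃! Y, IsCauchySolution A k Y := by
  refine ⟨Matrix.of fun i c => (cauchyOp A).inverse
    (0, fun j i => if j = k then (1 : Matrix (Fin m) (Fin m) ℂ) i c else 0) i, ?_, ?_⟩
  · exact (isCauchySolution_iff_eq_inverse hr).2 fun c => rfl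
  · intro Y hY
    ext i c
    exact congrFun ((isCauchySolution_iff_eq_inverse hr).1 hY c) i

theorem cauchySolution_eq_inverse (hr : 1 ≤ r)
    (A : Fin r → Matrix (Fin m) (Fin m) (Sobolev a b p n)) (k : Fin r) (c : Fin m) :
    (fun i => cauchySolution A k i c) = (cauchyOp A).inverse
      (0, fun j i => if j = k then (1 : Matrix (Fin m) (Fin m) ℂ) i c else 0) :=
  (isCauchySolution_iff_eq_inverse hr).1
    (Classical.epsilon_spec (existsUnique_isCauchySolution hr A k).exists) c

/-- Continuity is in operator norm: the coefficients enter only through the bounded bilinear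
`mulCLM`. -/
theorem continuous_cauchyOp :
    Continuous (cauchyOp : (Fin r → Matrix (Fin m) (Fin m) (Sobolev a b p n)) → _) := by
  unfold cauchyOp
  refine (continuous_const.clm_comp (continuous_finsetSum _ fun i _ =>
    continuous_const.clm_comp ?_)).add continuous_const
  unfold diffComponent
  refine continuous_const.add (continuous_finsetSum _ fun q _ => continuous_finsetSum _ fun j _ =>
    ((Sobolev.mulCLM a b p n).continuous.comp ?_).clm_comp continuous_const)
  exact (continuous_apply_apply i j).comp (continuous_apply q)

end BoundaryValueOperators

/-! ### From strong convergence to convergence of the characteristic matrices -/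

section StrongConvergence

variable {a b : ℝ} [hab : Fact (a < b)] {p : ℝ≥0∞} [hp : Fact (1 ≤ p)] {m n r l : ℕ}

/-- There is a function (the monomial `(t - a)^q / q!`) whose `q`-th derivative is `1`. -/
theorem Sobolev.exists_deriv_eqOn_one (q : ℕ) : ∀ s, q < s →
    ∃ P : Sobolev a b p s, EqOn (P.deriv q) (fun _ => 1) (Icc a b) := by
  induction q with
  | zero =>
    intro s hs
    obtain ⟨s, rfl⟩ : ∃ s', s = s' + 1 := ⟨s - 1, by omega⟩
    have h1 : ∀ j : ℕ, SobolevMem a b p j (fun _ => (1 : ℂ)) := by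
      intro j
      induction j with
      | zero => exact memLp_of_continuousOn_Icc continuousOn_const p
      | succ j _ =>
        exact SobolevMem.of_eq_add_integral (c := 1) (g := 0) hp.out hab.out SobolevMem.zero
          fun t _ => by simp
    exact ⟨mkFun _ (h1 _), (deriv_mkFun_eqOn (h1 _) hs).trans (by simp [EqOn])⟩
  | succ q IH =>
    intro s hs
    obtain ⟨s, rfl⟩ : ∃ s', s = s' + 1 := ⟨s - 1, by omega⟩
    obtain ⟨P, hP⟩ := IH s (by omega)
    obtain ⟨Q, -, hQ⟩ := exists_evalLeft_derivCLM_eq 0 P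
    refine ⟨Q, (deriv_derivCLM_eqOn le_rfl Q (by omega : q < s)).symm.trans ?_⟩
    rwa [hQ]

theorem Sobolev.derivCLM_eq_zero {s t q q' : ℕ} {P : Sobolev a b p s}
    (hP : EqOn (P.deriv q) (fun _ => 1) (Icc a b)) (hq : q < q') (h : t + q' ≤ s) :
    derivCLM h P = 0 := by
  refine ext_ae ((deriv_derivCLM_zero_ae h P).trans ?_)
  have h0 := deriv_smul (0 : ℂ) (0 : Sobolev a b p t) 0
  rw [zero_smul, zero_smul] at h0
  rw [h0]
  filter_upwards [ae_restrict_mem measurableSet_Icc] with x hx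
  obtain ⟨d, rfl⟩ : ∃ d, q' = d + 1 + q := ⟨q' - q - 1, by omega⟩
  have h1 : iteratedDerivWithin (d + 1) (P.deriv q) (Icc a b) = P.deriv (d + 1 + q) :=
    iteratedDerivWithin_iteratedDerivWithin _ _ _ _
  rw [← h1, iteratedDerivWithin_congr hP hx]
  simp [iteratedDerivWithin_const]

theorem Sobolev.mulCLM_derivCLM_eq {s q : ℕ} {P : Sobolev a b p s}
    (hP : EqOn (P.deriv q) (fun _ => 1) (Icc a b)) (h : n + 1 + q ≤ s) (u : Sobolev a b p n) :
    mulCLM a b p n u (derivCLM h P) = u := by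
  refine ext_ae ((deriv_mulCLM_ae u _).trans ?_)
  filter_upwards [ae_restrict_mem measurableSet_Icc, deriv_derivCLM_zero_ae h P] with x hx h1
  rw [Pi.mul_apply, h1, hP hx, mul_one]

/-- Isolates one coefficient: derivatives of `P` of order above `q` vanish, `A_q` is multiplied by
`1`, and only coefficients of smaller index remain. -/
theorem diffOp_single (A : Fin r → Matrix (Fin m) (Fin m) (Sobolev a b p n)) (i j : Fin m)
    (q : Fin r) {P : Sobolev a b p (n + r)} (hP : EqOn (P.deriv q) (fun _ => 1) (Icc a b)) :
    diffOp A (Pi.single j P) i = Sobolev.derivCLM (q := r) le_rfl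
      ((Pi.single j P : Fin m → Sobolev a b p (n + r)) i) +
      ((∑ q' ∈ Finset.univ.filter (· < q), Sobolev.mulCLM a b p n (A q' i j)
        (Sobolev.derivCLM (t := n + 1) (q := q') (by omega) P)) + A q i j) := by
  rw [diffOp_apply, diffComponent_apply]
  congr 1
  have h1 : ∀ q' : Fin r, ∑ j', Sobolev.mulCLM a b p n (A q' i j')
      (Sobolev.derivCLM (t := n + 1) (q := q') (by omega)
        ((Pi.single j P : Fin m → Sobolev a b p (n + r)) j')) =
      Sobolev.mulCLM a b p n (A q' i j)
        (Sobolev.derivCLM (t := n + 1) (q := q') (by omega) P) := fun q' => by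
    rw [Finset.sum_eq_single j (fun j' _ hj => by simp [Pi.single_eq_of_ne hj]) (by simp),
      Pi.single_eq_same]
  simp only [h1]
  rw [← Finset.sum_filter_add_sum_filter_not Finset.univ (· < q)]
  congr 1
  rw [Finset.sum_eq_single q]
  · exact Sobolev.mulCLM_derivCLM_eq hP _ _
  · intro q' hq' hne
    have hlt : q < q' := lt_of_le_of_ne (not_lt.1 (Finset.mem_filter.1 hq').2) (Ne.symm hne)
    rw [Sobolev.derivCLM_eq_zero hP hlt, map_zero]
  · simp

/-- Strong convergence of the differential operators forces convergence of the coefficients. -/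
theorem tendsto_coefficients {A : Fin r → Matrix (Fin m) (Fin m) (Sobolev a b p n)}
    {Ak : ℕ → Fin r → Matrix (Fin m) (Fin m) (Sobolev a b p n)}
    (h : ∀ y : Fin m → Sobolev a b p (n + r),
      Tendsto (fun k => diffOp (Ak k) y) atTop (𝓝 (diffOp A y))) :
    Tendsto Ak atTop (𝓝 A) := by
  have key : ∀ (q : Fin r) (i j : Fin m),
      Tendsto (fun k => Ak k q i j) atTop (𝓝 (A q i j)) := by
    intro q
    induction q using WellFoundedLT.induction with
    | ind q IH =>
      intro i j
      obtain ⟨P, hP⟩ := Sobolev.exists_deriv_eqOn_one (a := a) (b := b) (p := p) q.1 (n + r)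
        (by omega)
      have h1 := tendsto_pi_nhds.1 (h (Pi.single j P)) i
      simp only [diffOp_single _ i j q hP] at h1
      have h2 : Tendsto (fun k => ∑ q' ∈ Finset.univ.filter (· < q), Sobolev.mulCLM a b p n
          (Ak k q' i j) (Sobolev.derivCLM (t := n + 1) (q := q') (by omega) P)) atTop
          (𝓝 (∑ q' ∈ Finset.univ.filter (· < q), Sobolev.mulCLM a b p n (A q' i j)
          (Sobolev.derivCLM (t := n + 1) (q := q') (by omega) P))) :=
        tendsto_finsetSum _ fun q' hq' =>
          (((Sobolev.mulCLM a b p n).continuous.clm_apply continuous_const).tendsto _).comp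
            (IH q' (Finset.mem_filter.1 hq').2 i j)
      -- Subtracting the fixed leading term and the lower terms, convergent by induction, leaves the
      -- entry of `A_q`.
      simpa using (h1.sub (tendsto_const_nhds (x := Sobolev.derivCLM (q := r) le_rfl
        ((Pi.single j P : Fin m → Sobolev a b p (n + r)) i)))).sub h2
  exact tendsto_pi_nhds.2 fun q => tendsto_pi_nhds.2 fun i => tendsto_pi_nhds.2 fun j => key q i j

/-- A strongly convergent sequence of bounded operators on a Banach space may be evaluated along a
convergent sequence. -/
theorem tendsto_clm_apply_of_tendsto {𝕜 E F : Type*} [NontriviallyNormedField 𝕜]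
    [NormedAddCommGroup E] [NormedSpace 𝕜 E] [CompleteSpace E] [NormedAddCommGroup F]
    [NormedSpace 𝕜 F] {T : ℕ → E →L[𝕜] F} {T₀ : E →L[𝕜] F}
    (hT : ∀ x, Tendsto (fun k => T k x) atTop (𝓝 (T₀ x))) {x : ℕ → E} {x₀ : E}
    (hx : Tendsto x atTop (𝓝 x₀)) : Tendsto (fun k => T k (x k)) atTop (𝓝 (T₀ x₀)) := by
  obtain ⟨C, hC⟩ := banach_steinhaus (g := T) fun x => by
    obtain ⟨C, hC⟩ := (Metric.isBounded_range_of_tendsto _ (hT x)).exists_norm_le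
    exact ⟨C, fun k => hC _ (mem_range_self k)⟩
  -- Split `T k (x k) = T k (x k - x₀) + T k x₀`; the uniform bound `C` handles the first term.
  have h1 : Tendsto (fun k => T k (x k - x₀)) atTop (𝓝 0) := by
    have h2 : Tendsto (fun k => C * ‖x k - x₀‖) atTop (𝓝 0) := by
      simpa using ((tendsto_iff_norm_sub_tendsto_zero.1 hx).const_mul C)
    exact squeeze_zero_norm (fun k => (T k).le_of_opNorm_le (hC k) _) h2
  simpa using h1.add (hT x₀)

theorem tendsto_charMatrix (hr : 1 ≤ r)
    {A : Fin r → Matrix (Fin m) (Fin m) (Sobolev a b p n)}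
    {B : (Fin m → Sobolev a b p (n + r)) →L[ℂ] (Fin l → ℂ)}
    {Ak : ℕ → Fin r → Matrix (Fin m) (Fin m) (Sobolev a b p n)}
    {Bk : ℕ → (Fin m → Sobolev a b p (n + r)) →L[ℂ] (Fin l → ℂ)}
    (hA : Tendsto Ak atTop (𝓝 A)) (hB : ∀ y, Tendsto (fun k => Bk k y) atTop (𝓝 (B y))) :
    Tendsto (fun k => charMatrix (Ak k) (Bk k)) atTop (𝓝 (charMatrix A B)) := by
  have hinv : Tendsto (fun k => (cauchyOp (Ak k)).inverse) atTop (𝓝 (cauchyOp A).inverse) :=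
    -- Smoothness of class `C^0` of inversion at an invertible operator is its continuity there.
    ((cauchyOp_isInvertible hr A).contDiffAt_map_inverse (n := 0)).continuousAt.tendsto.comp
      ((continuous_cauchyOp.tendsto A).comp hA)
  refine tendsto_pi_nhds.2 fun i => tendsto_pi_nhds.2 fun kc => ?_
  have hcol : Tendsto (fun k => fun j => cauchySolution (Ak k) kc.1 j kc.2) atTop
      (𝓝 (fun j => cauchySolution A kc.1 j kc.2)) := by
    rw [cauchySolution_eq_inverse hr]
    refine (tendsto_congr fun k => cauchySolution_eq_inverse hr (Ak k) _ _).2 ?_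
    exact ((continuous_eval_const _).tendsto _).comp hinv
  exact tendsto_pi_nhds.1 (tendsto_clm_apply_of_tendsto hB hcol) i

end StrongConvergence

theorem theorem3 {a b : ℝ} [Fact (a < b)] {p : ℝ≥0∞} [Fact (1 ≤ p)] {m n r l : ℕ}
    (hm : 1 ≤ m) (hr : 1 ≤ r) (hl : 1 ≤ l)
    (A : Fin r → Matrix (Fin m) (Fin m) (Sobolev a b p n))
    (B : (Fin m → Sobolev a b p (n + r)) →L[ℂ] (Fin l → ℂ))
    (Ak : ℕ → Fin r → Matrix (Fin m) (Fin m) (Sobolev a b p n))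
    (Bk : ℕ → (Fin m → Sobolev a b p (n + r)) →L[ℂ] (Fin l → ℂ))
    (hconv : ∀ y : Fin m → Sobolev a b p (n + r),
      Tendsto (fun k => bvpOp (Ak k) (Bk k) y) atTop (𝓝 (bvpOp A B y))) :
    (∀ j : Fin r, ∃! Y, IsCauchySolution A j Y) ∧
    (∀ (k : ℕ) (j : Fin r), ∃! Y, IsCauchySolution (Ak k) j Y) ∧
    Tendsto (fun k => charMatrix (Ak k) (Bk k)) atTop (𝓝 (charMatrix A B)) :=
  ⟨existsUnique_isCauchySolution hr A, fun k => existsUnique_isCauchySolution hr (Ak k),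
    tendsto_charMatrix hr
      (tendsto_coefficients fun y => (continuous_fst.tendsto _).comp (hconv y))
      fun y => (continuous_snd.tendsto _).comp (hconv y)⟩
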